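/- Let $0<\alpha<1$, $T>0$, $\lambda\in\mathbb R$, $r\ge 1$ and let $n\ge 0$ be an integer. For $\nu>0$ put $I_t^{\nu}g(t)=\frac1{\Gamma(\nu)}\int_0^t (t-s)^{\nu-1}g(s)\,ds$ and $\partial_t^\alpha g=I_t^{1-\alpha}g'$. Let $f$ be differentiable on $[0,T]$ and twice differentiable on $(0,T]$ with $|f'(t)|\le Ct^{-\sigma}$ and $|f''(t)|\le Ct^{-\tilde\sigma}$ for $t\in(0,T]$, for some constants $C$ and $\sigma,\tilde\sigma<1$. Let $u$ be the (absolutely continuous) solution of $$\partial_t^\alpha u(t)+\lambda u(t)=f(t),\quad t\in(0,T],\qquad u(0)=0.$$ For an integer $M\ge1$ let $\tau=T^{1/r}/M$, $t_m=(m\tau)^r$ for $0\le m\le M$, $\tau_m=t_m-t_{m-1}$, and for $1\le m\le M$ let $$D_M^\alpha V^m=\frac1{\Gamma(2-\alpha)}\sum_{k=0}^{m-1}\frac{V^{k+1}-V^k}{\tau_{k+1}}\left[(t_m-t_k)^{1-\alpha}-(t_m-t_{k+1})^{1-\alpha}\right]$$ be the nonuniform L1 formula. Let $(V^m)_{0\le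 m\le M}$ solve the L1 scheme $$D_M^\alpha V^m+\lambda V^m=\big((-\lambda I_t^\alpha)^nf\big)(t_m),\quad 1\le m\le M,\qquad V^0=0,$$ for the remainder $v=u-I_t^\alpha\sum_{i=0}^{n-1}(-\lambda I_t^\alpha)^if$ of the multiscale solution decomposition, and let $$U^m=V^m+\Big(I_t^\alpha\sum_{i=0}^{n-1}(-\lambda I_t^\alpha)^if\Big)(t_m).$$ Then there is a constant $Q>0$, independent of $M$ and $m$, such that for every $M\ge1$ for which the scheme is uniquely solvable (that is, $\tau_m^{-\alpha}/\Gamma(2-\alpha)+\lambda\ne0$ for $1\le m\le M$, which always holds if $\lambda\ge0$), $$|u(t_m)-U^m|\le Q\,\tau^{\min\{2-\alpha,\;r(n+1)\alpha\}},\qquad 1\le m\le M.$$ -/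

import Mathlib

namespace MSD

noncomputable section

/-- The fractional integral `I_t^ν v (t) = 1 / Γ(ν) * ∫_0^t v(s) / (t - s)^(1 - ν) ds`. -/
def fracIntegral (ν : ℝ) (v : ℝ → ℝ) (t : ℝ) : ℝ :=
  1 / Real.Gamma ν * ∫ s in (0 : ℝ)..t, v s / (t - s) ^ (1 - ν)

/-- The fractional derivative `∂_t^α v = I_t^(1 - α) v'`. -/
def fracDeriv (α : ℝ) (v : ℝ → ℝ) (t : ℝ) : ℝ :=
  fracIntegral (1 - α) (deriv v) t

/-- `u` is an (absolutely continuous) solution of the fractional relaxation problem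
`∂_t^α u + lam u = f` on `(0, T]`, `u(0) = 0`. The field `integrable` says that the integral that
defines `∂_t^α u (t)` converges. -/
structure IsRelaxationSolution (α T lam : ℝ) (f u : ℝ → ℝ) : Prop where
  absCont : AbsolutelyContinuousOnInterval u 0 T
  init : u 0 = 0
  integrable : ∀ t ∈ Set.Ioc 0 T,
    IntervalIntegrable (fun s => deriv u s / (t - s) ^ α) MeasureTheory.volume 0 t
  eqn : ∀ t ∈ Set.Ioc 0 T, fracDeriv α u t + lam * u t = f t

/-- The iterated operator `(-lam I_t^α)^i` applied to `f`. -/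
def iterOp (α lam : ℝ) (i : ℕ) (f : ℝ → ℝ) : ℝ → ℝ :=
  (fun g t => -lam * fracIntegral α g t)^[i] f

/-- The known part `I_t^α ∑_{i=0}^{n-1} (-lam I_t^α)^i f` of the multiscale decomposition
`u = v + I_t^α ∑_{i=0}^{n-1} (-lam I_t^α)^i f`. -/
def singularPart (α lam : ℝ) (n : ℕ) (f : ℝ → ℝ) : ℝ → ℝ :=
  fracIntegral α (fun t => ∑ i ∈ Finset.range n, iterOp α lam i f t)

/-- The mesh parameter `τ = T^(1/r) / M`. -/
def meshParam (T r : ℝ) (M : ℕ) : ℝ := T ^ (1 / r) / M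

/-- The graded mesh `t_m = (m τ)^r`. -/
def node (T r : ℝ) (M m : ℕ) : ℝ := (m * meshParam T r M) ^ r

/-- The local step size indexed from zero: `meshStep T r M k = t_(k+1) - t_k`. -/
def meshStep (T r : ℝ) (M k : ℕ) : ℝ := node T r M (k + 1) - node T r M k

/-- The nonuniform L1 formula `D_M^α V^m` for the fractional derivative at `t_m`. -/
def l1Deriv (α T r : ℝ) (M : ℕ) (V : ℕ → ℝ) (m : ℕ) : ℝ :=
  1 / Real.Gamma (2 - α) * ∑ k ∈ Finset.range m,
    (V (k + 1) - V k) / meshStep T r M k *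
      ((node T r M m - node T r M k) ^ (1 - α) - (node T r M m - node T r M (k + 1)) ^ (1 - α))

/-- `V^0, …, V^M` solve the nonuniform L1 scheme for the remainder equation
`∂_t^α v + lam v = (-lam I_t^α)^n f`, `v(0) = 0`. -/
structure IsL1Solution (α T lam r : ℝ) (n M : ℕ) (f : ℝ → ℝ) (V : ℕ → ℝ) : Prop where
  init : V 0 = 0
  eqn : ∀ m : ℕ, 1 ≤ m → m ≤ M →
    l1Deriv α T r M V m + lam * V m = iterOp α lam n f (node T r M m)

/-- The diagonal coefficients `τ_(k+1)^(-α) / Γ(2 - α) + lam` of the triangular linear system of the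
L1 scheme are nonzero, i.e. the scheme is uniquely solvable. This always holds if `0 ≤ lam`. -/
def IsNondegenerate (α T lam r : ℝ) (M : ℕ) : Prop :=
  ∀ k : ℕ, k < M → meshStep T r M k ^ (-α) / Real.Gamma (2 - α) + lam ≠ 0

/-- The numerical solution `U^m = V^m + I_t^α ∑_{i=0}^{n-1} (-lam I_t^α)^i f (t_m)`. -/
def recover (α T lam r : ℝ) (n M : ℕ) (f : ℝ → ℝ) (V : ℕ → ℝ) (m : ℕ) : ℝ :=
  V m + singularPart α lam n f (node T r M m)

end

end MSD

/-!
The error splits into consistency and stability of the L1 scheme for the remainder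
`v = u - I^α ∑_{i<n} (-lam I^α)^i f`.

*Regularity.* Applying `I^α` to the equation gives `u = I^α (f - lam u)`, whence `v` arises from
`u` by `n` applications of `-lam I^α`. Written over the fixed interval `(0, 1)`, the fractional
integral is `t^ν / Γ(ν) ∫_0^1 v(tx) (1-x)^(ν-1) dx`, and differentiating in `t` shows that `I^ν`
maps functions with `|v^(k)| ≤ C t^(γ-k)`, `k ≤ 2`, to functions of the same kind with `γ + ν` in
place of `γ` (`PowerRegular.fracIntegral`). The hypotheses put `f` in this class for `γ = 0`. That
`u` belongs to it follows from the semigroup law `I^a I^b = I^(a+b)`: for large `N` the operator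
`(I^α)^N` integrates more than twice, so the remainder of order `N` is twice differentiable merely
because `u` is bounded. Consequently `v` behaves like `t^((n+1)α)` (`remainder_powerRegular`).

*Consistency.* On each mesh interval `v'` minus the slope of `v` has integral zero, so only the
oscillation of the kernel `(t_m - s)^(-α)` is seen. With `r γ ≤ 2 - α`, which can be arranged by
lowering `γ`, the interval number `k` contributes at most `τ^(rγ) (k+1)^(-α)` times the increment
of the kernel, and summation by splitting the mesh at `m / 2` bounds the truncation error by a
multiple of `τ^(rγ) t_m^(-α)` (`exists_truncation_error_bound`).

*Stability.* The L1 formula has positive coefficients increasing towards the diagonal, so `D_M^α +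
lam` obeys a maximum principle as soon as its diagonal is positive. The comparison function that
is `0` at `t_0` and `exp (κ t_m)` afterwards has an L1 derivative that dominates both `t_m^(-α)`
and, for large `κ`, any multiple of itself; this yields a bounded error for right-hand sides of
size `t_m^(-α)` on all sufficiently fine meshes (`exists_l1_stability`). The finitely many coarse
meshes are covered because the nondegenerate scheme has at most one solution on each.
-/

open MeasureTheory Set Filter Topology

/-! ### Fractional integrals over a fixed interval -/

theorem beta_weight_integrableOn {a b : ℝ} (ha : 0 < a) (hb : 0 < b) :
    IntegrableOn (fun x : ℝ => x ^ (a - 1) * (1 - x) ^ (b - 1)) (Ioo 0 1) := by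
  have h := Complex.betaIntegral_convergent (u := a) (v := b) (by simpa) (by simpa)
  rw [intervalIntegrable_iff_integrableOn_Ioo_of_le zero_le_one] at h
  refine (h.re).congr ?_
  filter_upwards [ae_restrict_mem measurableSet_Ioo] with x hx
  have h1 : (0 : ℝ) ≤ 1 - x := by linarith [hx.2]
  have e1 : ((x : ℂ) ^ ((a : ℂ) - 1)) = ((x ^ (a - 1) : ℝ) : ℂ) := by
    rw [Complex.ofReal_cpow hx.1.le]; push_cast; rfl
  have e2 : ((1 - (x : ℂ)) ^ ((b : ℂ) - 1)) = (((1 - x) ^ (b - 1) : ℝ) : ℂ) := by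
    rw [Complex.ofReal_cpow h1]; push_cast; rfl
  rw [e1, e2, ← Complex.ofReal_mul]
  simp

theorem integral_beta_weight {a b : ℝ} (ha : 0 < a) (hb : 0 < b) :
    ∫ x in Ioo (0 : ℝ) 1, x ^ (a - 1) * (1 - x) ^ (b - 1)
      = Real.Gamma a * Real.Gamma b / Real.Gamma (a + b) := by
  have h := ProbabilityTheory.beta_eq_betaIntegralReal a b ha hb
  rw [ProbabilityTheory.beta] at h
  rw [h, Complex.betaIntegral, intervalIntegral.integral_of_le zero_le_one,
    integral_Ioc_eq_integral_Ioo]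
  have : ∫ x in Ioo (0 : ℝ) 1, (x : ℂ) ^ ((a : ℂ) - 1) * (1 - (x : ℂ)) ^ ((b : ℂ) - 1)
      = ∫ x in Ioo (0 : ℝ) 1, ((x ^ (a - 1) * (1 - x) ^ (b - 1) : ℝ) : ℂ) := by
    refine setIntegral_congr_fun measurableSet_Ioo fun x hx => ?_
    have h1 : (0 : ℝ) ≤ 1 - x := by linarith [hx.2]
    rw [Complex.ofReal_mul, Complex.ofReal_cpow hx.1.le, Complex.ofReal_cpow h1]
    push_cast; rfl
  rw [this, integral_complex_ofReal, Complex.ofReal_re]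

/-- The integral `∫_0^1 x^j g(tx) (1-x)^(ν-1) dx` with a fixed domain. For `j = 0` it is, up to the
factor `t^ν / Γ(ν)`, the fractional integral; each derivative in `t` raises `j` by one. -/
noncomputable def scaledIntegral (ν : ℝ) (j : ℕ) (g : ℝ → ℝ) (t : ℝ) : ℝ :=
  ∫ x in Ioo (0 : ℝ) 1, g (t * x) * (x ^ j * (1 - x) ^ (ν - 1))

theorem fracIntegral_eq_setIntegral {ν t : ℝ} (ht : 0 ≤ t) (g : ℝ → ℝ) :
    MSD.fracIntegral ν g t
      = 1 / Real.Gamma ν * ∫ s in Ioo 0 t, g s * (t - s) ^ (ν - 1) := by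
  rw [MSD.fracIntegral, intervalIntegral.integral_of_le ht, integral_Ioc_eq_integral_Ioo]
  congr 1
  refine setIntegral_congr_fun measurableSet_Ioo fun s hs => ?_
  rw [div_eq_mul_inv, ← Real.rpow_neg (by linarith [hs.2]), neg_sub]

theorem fracIntegral_eq_scaledIntegral {ν t : ℝ} (ht : 0 < t) (g : ℝ → ℝ) :
    MSD.fracIntegral ν g t = t ^ ν / Real.Gamma ν * scaledIntegral ν 0 g t := by
  have h := intervalIntegral.mul_integral_comp_mul_left (a := 0) (b := 1)
    (f := fun s => g s * (t - s) ^ (ν - 1)) t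
  rw [mul_zero, mul_one, intervalIntegral.integral_of_le zero_le_one,
    intervalIntegral.integral_of_le ht.le, integral_Ioc_eq_integral_Ioo,
    integral_Ioc_eq_integral_Ioo] at h
  rw [fracIntegral_eq_setIntegral ht.le, ← h, scaledIntegral]
  have : ∫ x in Ioo (0 : ℝ) 1, g (t * x) * (t - t * x) ^ (ν - 1)
      = t ^ (ν - 1) * ∫ x in Ioo (0 : ℝ) 1, g (t * x) * (x ^ 0 * (1 - x) ^ (ν - 1)) := by
    rw [← integral_const_mul]
    refine setIntegral_congr_fun measurableSet_Ioo fun x hx => ?_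
    rw [show t - t * x = t * (1 - x) by ring,
      Real.mul_rpow ht.le (by linarith [hx.2])]
    ring
  rw [this, Real.rpow_sub_one ht.ne']
  field_simp

theorem fracIntegral_congr {ν t : ℝ} (ht : 0 ≤ t) {g h : ℝ → ℝ} (H : ∀ s ∈ Ioo 0 t, g s = h s) :
    MSD.fracIntegral ν g t = MSD.fracIntegral ν h t := by
  rw [fracIntegral_eq_setIntegral ht, fracIntegral_eq_setIntegral ht]
  congr 1
  refine setIntegral_congr_fun measurableSet_Ioo fun s hs => ?_
  simp only [H s hs]

theorem fracIntegral_zero (ν : ℝ) (g : ℝ → ℝ) : MSD.fracIntegral ν g 0 = 0 := by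
  simp [MSD.fracIntegral]

theorem fracIntegral_const_mul (ν c : ℝ) (g : ℝ → ℝ) (t : ℝ) :
    MSD.fracIntegral ν (fun s => c * g s) t = c * MSD.fracIntegral ν g t := by
  simp only [MSD.fracIntegral, mul_div_assoc, intervalIntegral.integral_const_mul]
  ring

theorem fracIntegral_one {t : ℝ} (ht : 0 ≤ t) (g : ℝ → ℝ) :
    MSD.fracIntegral 1 g t = ∫ s in Ioo 0 t, g s := by
  rw [fracIntegral_eq_setIntegral ht]
  simp

/-- `g` is continuous on `(0, T)` and of size at most a multiple of `t^p`. -/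
structure PowerBounded (T p : ℝ) (g : ℝ → ℝ) : Prop where
  cont : ContinuousOn g (Ioo 0 T)
  bound : ∃ C : ℝ, ∀ t ∈ Ioo 0 T, |g t| ≤ C * t ^ p

theorem mul_mem_Ioo {T t x : ℝ} (ht : t ∈ Ioc 0 T) (hx : x ∈ Ioo (0 : ℝ) 1) : t * x ∈ Ioo 0 T :=
  ⟨mul_pos ht.1 hx.1, by nlinarith [ht.1, ht.2, hx.1, hx.2]⟩

theorem integrable_scaled_weight {ν p : ℝ} {j : ℕ} (hν : 0 < ν) (hp : -1 < p + j) (c : ℝ) :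
    Integrable (fun x : ℝ => c * (x ^ (p + j) * (1 - x) ^ (ν - 1)))
      (volume.restrict (Ioo 0 1)) := by
  have := beta_weight_integrableOn (a := p + j + 1) (b := ν) (by linarith) hν
  simp only [add_sub_cancel_right] at this
  exact this.const_mul c

theorem norm_scaled_integrand_le {ν T p C t x : ℝ} {j : ℕ} {g : ℝ → ℝ}
    (hg : ∀ t ∈ Ioo 0 T, |g t| ≤ C * t ^ p) (ht : t ∈ Ioc 0 T) (hx : x ∈ Ioo (0 : ℝ) 1) :
    ‖g (t * x) * (x ^ j * (1 - x) ^ (ν - 1))‖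
      ≤ C * t ^ p * (x ^ (p + j) * (1 - x) ^ (ν - 1)) := by
  have h := hg _ (mul_mem_Ioo ht hx)
  have h1 : 0 ≤ (1 - x) ^ (ν - 1) := Real.rpow_nonneg (by linarith [hx.2]) _
  have h2 : 0 ≤ x ^ j := pow_nonneg hx.1.le _
  rw [Real.norm_eq_abs, abs_mul, abs_of_nonneg (mul_nonneg h2 h1), Real.rpow_add hx.1,
    Real.rpow_natCast]
  rw [Real.mul_rpow ht.1.le hx.1.le] at h
  calc _ ≤ C * (t ^ p * x ^ p) * (x ^ j * (1 - x) ^ (ν - 1)) :=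
        mul_le_mul_of_nonneg_right h (mul_nonneg h2 h1)
    _ = _ := by ring

theorem aestronglyMeasurable_scaled_integrand {ν T t : ℝ} {j : ℕ} {g : ℝ → ℝ}
    (hg : ContinuousOn g (Ioo 0 T)) (ht : t ∈ Ioc 0 T) :
    AEStronglyMeasurable (fun x => g (t * x) * (x ^ j * (1 - x) ^ (ν - 1)))
      (volume.restrict (Ioo (0 : ℝ) 1)) := by
  refine ContinuousOn.aestronglyMeasurable ?_ measurableSet_Ioo
  refine ContinuousOn.mul (hg.comp (by fun_prop) fun x hx => mul_mem_Ioo ht hx) ?_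
  refine ContinuousOn.mul (by fun_prop) ?_
  refine ContinuousOn.rpow_const (by fun_prop) fun x hx => Or.inl ?_
  linarith [hx.2]

theorem integrable_scaled_integrand {ν T p t : ℝ} {j : ℕ} {g : ℝ → ℝ} (hν : 0 < ν)
    (hp : -1 < p + j) (hg : PowerBounded T p g) (ht : t ∈ Ioc 0 T) :
    Integrable (fun x => g (t * x) * (x ^ j * (1 - x) ^ (ν - 1)))
      (volume.restrict (Ioo (0 : ℝ) 1)) := by
  obtain ⟨C, hC⟩ := hg.bound
  refine (integrable_scaled_weight hν hp (C * t ^ p)).mono'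
    (aestronglyMeasurable_scaled_integrand hg.cont ht) ?_
  filter_upwards [ae_restrict_mem measurableSet_Ioo] with x hx
  exact norm_scaled_integrand_le hC ht hx

theorem abs_scaledIntegral_le {ν T p : ℝ} {j : ℕ} {g : ℝ → ℝ} (hν : 0 < ν) (hp : -1 < p + j)
    (hg : ∃ C : ℝ, ∀ t ∈ Ioo 0 T, |g t| ≤ C * t ^ p) :
    ∃ C : ℝ, ∀ t ∈ Ioc 0 T, |scaledIntegral ν j g t| ≤ C * t ^ p := by
  obtain ⟨C, hC⟩ := hg
  refine ⟨C * ∫ x in Ioo (0 : ℝ) 1, x ^ (p + j) * (1 - x) ^ (ν - 1), fun t ht => ?_⟩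
  have := norm_integral_le_of_norm_le (integrable_scaled_weight hν hp (C * t ^ p))
    (f := fun x => g (t * x) * (x ^ j * (1 - x) ^ (ν - 1))) (by
      filter_upwards [ae_restrict_mem measurableSet_Ioo] with x hx
      exact norm_scaled_integrand_le hC ht hx)
  rw [integral_const_mul] at this
  calc _ ≤ _ := this
    _ = _ := by ring

theorem rpow_le_of_mem_Ioo_half_double {q t₀ t : ℝ} (h0 : 0 < t₀) (ht : t ∈ Ioo (t₀ / 2) (2 * t₀)) :
    t ^ q ≤ (t₀ / 2) ^ q + (2 * t₀) ^ q := by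
  have h1 : 0 < t₀ / 2 := by linarith
  have h2 : 0 < t := h1.trans ht.1
  rcases le_total 0 q with hq | hq
  · have := Real.rpow_le_rpow h2.le ht.2.le hq
    have := Real.rpow_nonneg h1.le q
    linarith
  · have := Real.rpow_le_rpow_of_nonpos h1 ht.1.le hq
    have := Real.rpow_nonneg (show 0 ≤ 2 * t₀ by linarith) q
    linarith

theorem continuousOn_scaledIntegral {ν T p : ℝ} {j : ℕ} {g : ℝ → ℝ} (hν : 0 < ν)
    (hp : -1 < p + j) (hg : PowerBounded T p g) :
    ContinuousOn (scaledIntegral ν j g) (Ioc 0 T) := by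
  obtain ⟨C, hC⟩ := hg.bound
  intro t₀ ht₀
  have hnhds : ∀ᶠ t in 𝓝[Ioc 0 T] t₀, t ∈ Ioc 0 T ∧ t ∈ Ioo (t₀ / 2) (2 * t₀) :=
    (eventually_mem_nhdsWithin).and <| mem_nhdsWithin_of_mem_nhds <|
      Ioo_mem_nhds (by linarith [ht₀.1]) (by linarith [ht₀.1])
  refine continuousWithinAt_of_dominated
    (bound := fun x => |C| * ((t₀ / 2) ^ p + (2 * t₀) ^ p) * (x ^ (p + j) * (1 - x) ^ (ν - 1)))
    ?_ ?_ (integrable_scaled_weight hν hp _) ?_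
  · filter_upwards [hnhds] with t ht
    exact aestronglyMeasurable_scaled_integrand hg.cont ht.1
  · filter_upwards [hnhds] with t ht
    filter_upwards [ae_restrict_mem measurableSet_Ioo] with x hx
    refine (norm_scaled_integrand_le hC ht.1 hx).trans ?_
    have h1 : 0 ≤ (1 - x) ^ (ν - 1) := Real.rpow_nonneg (by linarith [hx.2]) _
    have h2 : 0 ≤ x ^ (p + j) := Real.rpow_nonneg hx.1.le _
    refine mul_le_mul_of_nonneg_right ?_ (mul_nonneg h2 h1)
    exact mul_le_mul (le_abs_self C) (rpow_le_of_mem_Ioo_half_double ht₀.1 ht.2)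
      (Real.rpow_nonneg ht.1.1.le _) (abs_nonneg C)
  · filter_upwards [ae_restrict_mem measurableSet_Ioo] with x hx
    refine ContinuousWithinAt.mul ?_ continuousWithinAt_const
    have : ContinuousAt g (t₀ * x) := hg.cont.continuousAt (Ioo_mem_nhds (mul_mem_Ioo ht₀ hx).1
      (mul_mem_Ioo ht₀ hx).2)
    exact (ContinuousAt.comp (f := fun t => t * x) this (by fun_prop)).continuousWithinAt

/-- Differentiation under the integral sign: since `∂_t g(tx) = x g'(tx)`, a blow-up `t^(p-1)` of
`g'` at the origin is compensated by the extra factor `x`. -/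
theorem hasDerivAt_scaledIntegral {ν T p : ℝ} {j : ℕ} {g g' : ℝ → ℝ} (hν : 0 < ν)
    (hp : -1 < p + j) (hg : PowerBounded T p g) (hd : ∀ t ∈ Ioo 0 T, HasDerivAt g (g' t) t)
    (hg' : ∃ C : ℝ, ∀ t ∈ Ioo 0 T, |g' t| ≤ C * t ^ (p - 1)) {t₀ : ℝ} (ht₀ : t₀ ∈ Ioo 0 T) :
    HasDerivAt (scaledIntegral ν j g) (scaledIntegral ν (j + 1) g' t₀) t₀ := by
  obtain ⟨C, hC⟩ := hg'
  have hs : Ioo (t₀ / 2) (2 * t₀) ∩ Ioo 0 T ∈ 𝓝 t₀ :=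
    inter_mem (Ioo_mem_nhds (by linarith [ht₀.1]) (by linarith [ht₀.1])) (Ioo_mem_nhds ht₀.1 ht₀.2)
  have hsub : ∀ t ∈ Ioo (t₀ / 2) (2 * t₀) ∩ Ioo 0 T, t ∈ Ioc 0 T :=
    fun t ht => ⟨ht.2.1, ht.2.2.le⟩
  have hp' : -1 < (p - 1) + ((j + 1 : ℕ) : ℝ) := by push_cast; linarith
  refine (hasDerivAt_integral_of_dominated_loc_of_deriv_le
    (F := fun t x => g (t * x) * (x ^ j * (1 - x) ^ (ν - 1)))
    (F' := fun t x => g' (t * x) * (x ^ (j + 1) * (1 - x) ^ (ν - 1)))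
    (bound := fun x => |C| * ((t₀ / 2) ^ (p - 1) + (2 * t₀) ^ (p - 1)) *
      (x ^ ((p - 1) + ((j + 1 : ℕ) : ℝ)) * (1 - x) ^ (ν - 1)))
    hs ?_ ?_ ?_ ?_ (integrable_scaled_weight hν hp' _) ?_).2
  · filter_upwards [hs] with t ht
    exact aestronglyMeasurable_scaled_integrand hg.cont (hsub t ht)
  · exact integrable_scaled_integrand hν hp hg ⟨ht₀.1, ht₀.2.le⟩
  · have h1 : AEStronglyMeasurable (fun x => deriv g (t₀ * x) * (x ^ (j + 1) * (1 - x) ^ (ν - 1)))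
        (volume.restrict (Ioo (0 : ℝ) 1)) := by
      have := measurable_deriv g
      exact Measurable.aestronglyMeasurable (by fun_prop)
    refine h1.congr ?_
    filter_upwards [ae_restrict_mem measurableSet_Ioo] with x hx
    rw [(hd _ (mul_mem_Ioo ⟨ht₀.1, ht₀.2.le⟩ hx)).deriv]
  · filter_upwards [ae_restrict_mem measurableSet_Ioo] with x hx t ht
    refine (norm_scaled_integrand_le hC (hsub t ht) hx).trans ?_
    have h1 : 0 ≤ (1 - x) ^ (ν - 1) := Real.rpow_nonneg (by linarith [hx.2]) _
    have h2 : 0 ≤ x ^ ((p - 1) + ((j + 1 : ℕ) : ℝ)) := Real.rpow_nonneg hx.1.le _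
    refine mul_le_mul_of_nonneg_right ?_ (mul_nonneg h2 h1)
    exact mul_le_mul (le_abs_self C) (rpow_le_of_mem_Ioo_half_double ht₀.1 ht.1)
      (Real.rpow_nonneg ht.2.1.le _) (abs_nonneg C)
  · filter_upwards [ae_restrict_mem measurableSet_Ioo] with x hx t ht
    have h := (hd _ (mul_mem_Ioo (hsub t ht) hx)).comp t
      ((hasDerivAt_id t).mul_const x)
    have h' := h.mul_const (x ^ j * (1 - x) ^ (ν - 1))
    refine h'.congr_deriv ?_
    simp only [one_mul]
    ring

/-! ### The semigroup law -/

theorem integral_beta_kernel {a b s t : ℝ} (ha : 0 < a) (hb : 0 < b) (hst : s < t) :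
    ∫ x in Ioo s t, (t - x) ^ (a - 1) * (x - s) ^ (b - 1)
      = (t - s) ^ (a + b - 1) * (Real.Gamma a * Real.Gamma b / Real.Gamma (a + b)) := by
  have h0 : 0 < t - s := by linarith
  have h := intervalIntegral.mul_integral_comp_mul_add (a := 0) (b := 1)
    (f := fun x => (t - x) ^ (a - 1) * (x - s) ^ (b - 1)) (t - s) s
  rw [mul_zero, mul_one, zero_add, sub_add_cancel, intervalIntegral.integral_of_le zero_le_one,
    intervalIntegral.integral_of_le hst.le, integral_Ioc_eq_integral_Ioo,
    integral_Ioc_eq_integral_Ioo] at h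
  rw [← h, mul_comm (Real.Gamma a), add_comm a b, ← integral_beta_weight hb ha,
    ← integral_const_mul, ← integral_const_mul]
  refine setIntegral_congr_fun measurableSet_Ioo fun x hx => ?_
  have h1 : 0 ≤ 1 - x := by linarith [hx.2]
  rw [show t - ((t - s) * x + s) = (t - s) * (1 - x) by ring,
    show (t - s) * x + s - s = (t - s) * x by ring, Real.mul_rpow h0.le h1,
    Real.mul_rpow h0.le hx.1.le, show b + a - 1 = 1 + (a - 1) + (b - 1) by ring,
    Real.rpow_add h0, Real.rpow_add h0, Real.rpow_one]
  ring

theorem integrableOn_beta_kernel {a b s t : ℝ} (ha : 0 < a) (hb : 0 < b) (hst : s < t) :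
    IntegrableOn (fun x => (t - x) ^ (a - 1) * (x - s) ^ (b - 1)) (Ioo s t) := by
  by_contra hn
  have h := integral_beta_kernel ha hb hst
  rw [integral_undef hn] at h
  have := Real.Gamma_pos_of_pos ha
  have := Real.Gamma_pos_of_pos hb
  have := Real.Gamma_pos_of_pos (add_pos ha hb)
  have := Real.rpow_pos_of_pos (sub_pos.2 hst) (a + b - 1)
  have : 0 < (t - s) ^ (a + b - 1) * (Real.Gamma a * Real.Gamma b / Real.Gamma (a + b)) := by
    positivity
  linarith

theorem setIntegral_Ioo_indicator_Iio {t x : ℝ} (hx : x ∈ Ioo 0 t) (F : ℝ → ℝ) :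
    ∫ s in Ioo 0 t, (if s < x then F s else 0) = ∫ s in Ioo 0 x, F s := by
  have : (fun s => if s < x then F s else 0) = (Iio x).indicator F := by
    ext s; simp [indicator_apply]
  rw [this, setIntegral_indicator measurableSet_Iio]
  congr 2
  ext s
  simp only [mem_inter_iff, mem_Ioo, mem_Iio]
  exact ⟨fun h => ⟨h.1.1, h.2⟩, fun h => ⟨⟨h.1, h.2.trans hx.2⟩, h.2⟩⟩

theorem setIntegral_Ioo_indicator_Ioi {s t : ℝ} (hs : s ∈ Ioo 0 t) (F : ℝ → ℝ) :
    ∫ x in Ioo 0 t, (if s < x then F x else 0) = ∫ x in Ioo s t, F x := by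
  have : (fun x => if s < x then F x else 0) = (Ioi s).indicator F := by
    ext x; simp [indicator_apply]
  rw [this, setIntegral_indicator measurableSet_Ioi]
  congr 2
  ext x
  simp only [mem_inter_iff, mem_Ioo, mem_Ioi]
  exact ⟨fun h => ⟨h.2, h.1.2⟩, fun h => ⟨⟨hs.1.trans h.1, h.2⟩, h.1⟩⟩

theorem integrableOn_Ioo_indicator_Ioi {s t : ℝ} {F : ℝ → ℝ}
    (hF : IntegrableOn F (Ioo s t)) :
    IntegrableOn (fun x => if s < x then F x else 0) (Ioo 0 t) := by
  have : (fun x => if s < x then F x else 0) = (Ioi s).indicator F := by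
    ext x; simp [indicator_apply]
  rw [this, IntegrableOn, integrable_indicator_iff measurableSet_Ioi, IntegrableOn,
    Measure.restrict_restrict measurableSet_Ioi]
  exact IntegrableOn.mono_set hF fun x hx => ⟨hx.1, hx.2.2⟩

/-- The semigroup law `I^a I^b g = I^(a+b) g` at the point `t`, for every `g` for which the right
side converges absolutely. -/
theorem fracIntegral_fracIntegral {a b t : ℝ} (ha : 0 < a) (hb : 0 < b) (ht : 0 < t) {g : ℝ → ℝ}
    (hm : AEStronglyMeasurable g (volume.restrict (Ioo 0 t)))
    (hg : IntegrableOn (fun s => g s * (t - s) ^ (a + b - 1)) (Ioo 0 t)) :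
    MSD.fracIntegral a (MSD.fracIntegral b g) t = MSD.fracIntegral (a + b) g t := by
  have hΓa := Real.Gamma_pos_of_pos ha
  have hΓb := Real.Gamma_pos_of_pos hb
  have hΓ := Real.Gamma_pos_of_pos (add_pos ha hb)
  set B := Real.Gamma a * Real.Gamma b / Real.Gamma (a + b) with hB
  set μ := volume.restrict (Ioo 0 t) with hμ
  -- Both orders of integration of `K` over the square are evaluated; the order that starts with
  -- `x` produces the beta integral.
  set K : ℝ → ℝ → ℝ := fun x s =>
    if s < x then g s * ((t - x) ^ (a - 1) * (x - s) ^ (b - 1)) else 0 with hK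
  have hKm : AEStronglyMeasurable (Function.uncurry K) (μ.prod μ) := by
    have h1 : AEStronglyMeasurable (fun p : ℝ × ℝ => g p.2) (μ.prod μ) := hm.comp_snd
    have h2 : Measurable (fun p : ℝ × ℝ => (t - p.1) ^ (a - 1) * (p.1 - p.2) ^ (b - 1)) := by
      fun_prop
    have h3 := (h1.mul h2.aestronglyMeasurable).indicator
      (measurableSet_lt measurable_snd measurable_fst : MeasurableSet {p : ℝ × ℝ | p.2 < p.1})
    refine h3.congr (Eventually.of_forall fun p => ?_)
    simp [hK, indicator_apply, Function.uncurry]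
  have hKs : ∀ s ∈ Ioo 0 t, ∫ x in Ioo 0 t, K x s = g s * (t - s) ^ (a + b - 1) * B := by
    intro s hs
    rw [setIntegral_Ioo_indicator_Ioi hs, integral_const_mul, integral_beta_kernel ha hb hs.2]
    ring
  have hKint : Integrable (Function.uncurry K) (μ.prod μ) := by
    rw [integrable_prod_iff' hKm]
    constructor
    · filter_upwards [ae_restrict_mem measurableSet_Ioo] with s hs
      exact integrableOn_Ioo_indicator_Ioi ((integrableOn_beta_kernel ha hb hs.2).const_mul (g s))
    · refine (hg.norm.mul_const B).congr ?_
      filter_upwards [ae_restrict_mem measurableSet_Ioo] with s hs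
      have e : ∀ x ∈ Ioo 0 t, ‖Function.uncurry K (x, s)‖
          = if s < x then |g s| * ((t - x) ^ (a - 1) * (x - s) ^ (b - 1)) else 0 := by
        intro x hx
        simp only [Function.uncurry, hK]
        split_ifs with h
        · rw [Real.norm_eq_abs, abs_mul, abs_of_nonneg (mul_nonneg
            (Real.rpow_nonneg (by linarith [hx.2]) _) (Real.rpow_nonneg (by linarith) _))]
        · simp
      rw [setIntegral_congr_fun measurableSet_Ioo e, setIntegral_Ioo_indicator_Ioi hs,
        integral_const_mul, integral_beta_kernel ha hb hs.2, Real.norm_eq_abs, abs_mul,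
        abs_of_nonneg (Real.rpow_nonneg (sub_nonneg.2 hs.2.le) _)]
      ring
  have key : ∫ x in Ioo 0 t, MSD.fracIntegral b g x * (t - x) ^ (a - 1)
      = 1 / Real.Gamma b * ∫ x in Ioo 0 t, ∫ s in Ioo 0 t, K x s := by
    rw [← integral_const_mul]
    refine setIntegral_congr_fun measurableSet_Ioo fun x hx => ?_
    rw [setIntegral_Ioo_indicator_Iio hx, fracIntegral_eq_setIntegral hx.1.le, mul_assoc,
      ← integral_mul_const]
    congr 2
    ext s
    ring
  rw [fracIntegral_eq_setIntegral ht.le, key, integral_integral_swap hKint,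
    setIntegral_congr_fun measurableSet_Ioo hKs, integral_mul_const,
    fracIntegral_eq_setIntegral ht.le, hB]
  field_simp

theorem PowerBounded.integrableOn_fracIntegrand {ν p T t : ℝ} {g : ℝ → ℝ} (hν : 0 < ν) (hp : -1 < p)
    (hg : PowerBounded T p g) (ht : t ∈ Ioc 0 T) :
    IntegrableOn (fun s => g s * (t - s) ^ (ν - 1)) (Ioo 0 t) := by
  obtain ⟨C, hC⟩ := hg.bound
  have h := (integrableOn_beta_kernel (a := ν) (b := p + 1) (s := 0) hν (by linarith) ht.1).const_mul
    C
  refine Integrable.mono' h ?_ ?_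
  · refine ContinuousOn.aestronglyMeasurable ?_ measurableSet_Ioo
    refine (hg.cont.mono (Ioo_subset_Ioo_right ht.2)).mul ?_
    exact ContinuousOn.rpow_const (by fun_prop) fun x hx => Or.inl (by linarith [hx.2])
  · filter_upwards [ae_restrict_mem measurableSet_Ioo] with s hs
    have h1 := hC s ⟨hs.1, hs.2.trans_le ht.2⟩
    have h2 : 0 ≤ (t - s) ^ (ν - 1) := Real.rpow_nonneg (by linarith [hs.2]) _
    rw [Real.norm_eq_abs, abs_mul, abs_of_nonneg h2, add_sub_cancel_right, sub_zero]
    calc _ ≤ C * s ^ p * (t - s) ^ (ν - 1) := mul_le_mul_of_nonneg_right h1 h2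
      _ = _ := by ring

theorem fracIntegral_add {ν p T t : ℝ} {g h : ℝ → ℝ} (hν : 0 < ν) (hp : -1 < p)
    (hg : PowerBounded T p g) (hh : PowerBounded T p h) (ht : t ∈ Icc 0 T) :
    MSD.fracIntegral ν (fun s => g s + h s) t
      = MSD.fracIntegral ν g t + MSD.fracIntegral ν h t := by
  rcases ht.1.eq_or_lt with rfl | h0
  · simp [fracIntegral_zero]
  have ht' : t ∈ Ioc 0 T := ⟨h0, ht.2⟩
  simp only [fracIntegral_eq_setIntegral ht.1, add_mul]
  rw [integral_add (hg.integrableOn_fracIntegrand hν hp ht')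
    (hh.integrableOn_fracIntegrand hν hp ht'), mul_add]

theorem continuousOn_fracIntegral {ν p T : ℝ} {g : ℝ → ℝ} (hν : 0 < ν) (hp : -1 < p)
    (hg : PowerBounded T p g) : ContinuousOn (MSD.fracIntegral ν g) (Ioc 0 T) := by
  have h := continuousOn_scaledIntegral (j := 0) hν (by simpa using hp) hg
  refine ContinuousOn.congr (f := fun t => t ^ ν / Real.Gamma ν * scaledIntegral ν 0 g t) ?_
    fun t ht => fracIntegral_eq_scaledIntegral ht.1 g
  refine ContinuousOn.mul (ContinuousOn.div_const ?_ _) h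
  exact ContinuousOn.rpow_const (by fun_prop) fun x hx => Or.inl hx.1.ne'

theorem abs_fracIntegral_le {ν p T : ℝ} {g : ℝ → ℝ} (hν : 0 < ν) (hp : -1 < p)
    (hg : PowerBounded T p g) :
    ∃ C : ℝ, ∀ t ∈ Ioc 0 T, |MSD.fracIntegral ν g t| ≤ C * t ^ (p + ν) := by
  obtain ⟨C, hC⟩ := abs_scaledIntegral_le (j := 0) hν (by simpa using hp) hg.bound
  have hΓ := Real.Gamma_pos_of_pos hν
  refine ⟨C / Real.Gamma ν, fun t ht => ?_⟩
  have h1 : 0 ≤ t ^ ν / Real.Gamma ν := div_nonneg (Real.rpow_nonneg ht.1.le _) hΓ.le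
  rw [fracIntegral_eq_scaledIntegral ht.1, abs_mul, abs_of_nonneg h1, Real.rpow_add ht.1]
  calc _ ≤ t ^ ν / Real.Gamma ν * (C * t ^ p) := mul_le_mul_of_nonneg_left (hC t ht) h1
    _ = _ := by ring

theorem PowerBounded.fracIntegral {ν p T : ℝ} {g : ℝ → ℝ} (hν : 0 < ν) (hp : -1 < p)
    (hg : PowerBounded T p g) : PowerBounded T (p + ν) (MSD.fracIntegral ν g) := by
  refine ⟨(continuousOn_fracIntegral hν hp hg).mono Ioo_subset_Ioc_self, ?_⟩
  obtain ⟨C, hC⟩ := abs_fracIntegral_le hν hp hg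
  exact ⟨C, fun t ht => hC t ⟨ht.1, ht.2.le⟩⟩

/-! ### Functions with power-type singularities -/

theorem exists_rpow_bound_of_le {T p q : ℝ} (hpq : q ≤ p) {g : ℝ → ℝ}
    (hg : ∃ C : ℝ, ∀ t ∈ Ioo 0 T, |g t| ≤ C * t ^ p) :
    ∃ C : ℝ, ∀ t ∈ Ioo 0 T, |g t| ≤ C * t ^ q := by
  obtain ⟨C, hC⟩ := hg
  refine ⟨|C| * T ^ (p - q), fun t ht => (hC t ht).trans ?_⟩
  have h1 : t ^ (p - q) ≤ T ^ (p - q) := Real.rpow_le_rpow ht.1.le ht.2.le (by linarith)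
  have h2 : t ^ p = t ^ (p - q) * t ^ q := by rw [← Real.rpow_add ht.1, sub_add_cancel]
  rw [h2, mul_assoc]
  have h3 := Real.rpow_nonneg ht.1.le q
  have h4 := Real.rpow_nonneg ht.1.le (p - q)
  gcongr
  exact le_abs_self C

theorem exists_rpow_bound_add {T p : ℝ} {g h : ℝ → ℝ}
    (hg : ∃ C : ℝ, ∀ t ∈ Ioo 0 T, |g t| ≤ C * t ^ p)
    (hh : ∃ C : ℝ, ∀ t ∈ Ioo 0 T, |h t| ≤ C * t ^ p) :
    ∃ C : ℝ, ∀ t ∈ Ioo 0 T, |g t + h t| ≤ C * t ^ p := by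
  obtain ⟨C, hC⟩ := hg
  obtain ⟨D, hD⟩ := hh
  refine ⟨C + D, fun t ht => (abs_add_le _ _).trans ?_⟩
  rw [add_mul]
  exact add_le_add (hC t ht) (hD t ht)

theorem exists_rpow_bound_rpow_mul {T p q : ℝ} (c : ℝ) {g : ℝ → ℝ}
    (hg : ∃ C : ℝ, ∀ t ∈ Ioo 0 T, |g t| ≤ C * t ^ p) :
    ∃ C : ℝ, ∀ t ∈ Ioo 0 T, |c * t ^ q * g t| ≤ C * t ^ (p + q) := by
  obtain ⟨C, hC⟩ := hg
  refine ⟨|c| * C, fun t ht => ?_⟩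
  have h1 := Real.rpow_nonneg ht.1.le q
  rw [abs_mul, abs_mul, abs_of_nonneg h1, Real.rpow_add ht.1]
  calc _ ≤ |c| * t ^ q * (C * t ^ p) := mul_le_mul_of_nonneg_left (hC t ht) (by positivity)
    _ = _ := by ring

theorem exists_rpow_bound_const_mul {T p : ℝ} (c : ℝ) {g : ℝ → ℝ}
    (hg : ∃ C : ℝ, ∀ t ∈ Ioo 0 T, |g t| ≤ C * t ^ p) :
    ∃ C : ℝ, ∀ t ∈ Ioo 0 T, |c * g t| ≤ C * t ^ p := by
  simpa using exists_rpow_bound_rpow_mul (q := 0) c hg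

namespace PowerBounded

theorem add {T p : ℝ} {g h : ℝ → ℝ} (hg : PowerBounded T p g) (hh : PowerBounded T p h) :
    PowerBounded T p (fun t => g t + h t) :=
  ⟨hg.cont.add hh.cont, exists_rpow_bound_add hg.bound hh.bound⟩

theorem const_mul {T p : ℝ} {g : ℝ → ℝ} (c : ℝ) (hg : PowerBounded T p g) :
    PowerBounded T p (fun t => c * g t) :=
  ⟨continuousOn_const.mul hg.cont, exists_rpow_bound_const_mul c hg.bound⟩

theorem sub {T p : ℝ} {g h : ℝ → ℝ} (hg : PowerBounded T p g) (hh : PowerBounded T p h) :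
    PowerBounded T p (fun t => g t - h t) := by
  simpa [sub_eq_add_neg] using hg.add (hh.const_mul (-1))

theorem of_le {T p q : ℝ} {g : ℝ → ℝ} (hg : PowerBounded T p g) (hpq : q ≤ p) :
    PowerBounded T q g :=
  ⟨hg.cont, exists_rpow_bound_of_le hpq hg.bound⟩

theorem of_continuousOn {T : ℝ} {g : ℝ → ℝ} (hg : ContinuousOn g (Icc 0 T)) :
    PowerBounded T 0 g := by
  obtain ⟨C, hC⟩ := isCompact_Icc.exists_bound_of_continuousOn hg
  exact ⟨hg.mono Ioo_subset_Icc_self,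
    C, fun t ht => by simpa using hC t (Ioo_subset_Icc_self ht)⟩

end PowerBounded

theorem fracIntegral_sub {ν p T t : ℝ} {g h : ℝ → ℝ} (hν : 0 < ν) (hp : -1 < p)
    (hg : PowerBounded T p g) (hh : PowerBounded T p h) (ht : t ∈ Icc 0 T) :
    MSD.fracIntegral ν (fun s => g s - h s) t
      = MSD.fracIntegral ν g t - MSD.fracIntegral ν h t := by
  have h1 := fracIntegral_add hν hp hg (hh.const_mul (-1)) ht
  rw [fracIntegral_const_mul] at h1
  rw [sub_eq_add_neg, ← neg_one_mul, ← h1]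
  congr 1
  ext s
  ring

/-- The semigroup law on functions with an integrable power singularity at the origin. -/
theorem PowerBounded.fracIntegral_fracIntegral {a b p T t : ℝ} {g : ℝ → ℝ} (ha : 0 < a)
    (hb : 0 < b) (hp : -1 < p) (hg : PowerBounded T p g) (ht : t ∈ Icc 0 T) :
    MSD.fracIntegral a (MSD.fracIntegral b g) t = MSD.fracIntegral (a + b) g t := by
  rcases ht.1.eq_or_lt with rfl | h0
  · simp [fracIntegral_zero]
  refine _root_.fracIntegral_fracIntegral ha hb h0 ?_
    (hg.integrableOn_fracIntegrand (add_pos ha hb) hp ⟨h0, ht.2⟩)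
  exact (hg.cont.mono (Ioo_subset_Ioo_right ht.2)).aestronglyMeasurable measurableSet_Ioo

theorem PowerBounded.hasDerivAt_fracIntegral_one {p T t : ℝ} {g : ℝ → ℝ} (hp : -1 < p)
    (hg : PowerBounded T p g) (ht : t ∈ Ioo 0 T) :
    HasDerivAt (MSD.fracIntegral 1 g) (g t) t := by
  have hi : IntervalIntegrable g volume 0 t := by
    rw [intervalIntegrable_iff_integrableOn_Ioo_of_le ht.1.le]
    simpa using hg.integrableOn_fracIntegrand one_pos hp ⟨ht.1, ht.2.le⟩
  have hc : ContinuousAt g t := hg.cont.continuousAt (Ioo_mem_nhds ht.1 ht.2)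
  have h := intervalIntegral.integral_hasDerivAt_right hi
    (hg.cont.stronglyMeasurableAtFilter isOpen_Ioo t ht) hc
  refine h.congr_of_eventuallyEq ?_
  filter_upwards [Ioi_mem_nhds ht.1] with x hx
  rw [fracIntegral_one (mem_Ioi.1 hx).le, intervalIntegral.integral_of_le (mem_Ioi.1 hx).le,
    integral_Ioc_eq_integral_Ioo]

theorem eqOn_of_fracIntegral_one_eqOn {p T : ℝ} {g h : ℝ → ℝ} (hT : 0 < T) (hp : -1 < p)
    (hg : PowerBounded T p g) (hh : PowerBounded T p h) (hgc : ContinuousOn g (Ioc 0 T))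
    (hhc : ContinuousOn h (Ioc 0 T))
    (H : EqOn (MSD.fracIntegral 1 g) (MSD.fracIntegral 1 h) (Ioo 0 T)) : EqOn g h (Ioc 0 T) := by
  have h1 : EqOn g h (Ioo 0 T) := fun t ht => by
    refine (hg.hasDerivAt_fracIntegral_one hp ht).unique
      ((hh.hasDerivAt_fracIntegral_one hp ht).congr_of_eventuallyEq ?_)
    filter_upwards [Ioo_mem_nhds ht.1 ht.2] with x hx using H hx
  refine h1.of_subset_closure hgc hhc Ioo_subset_Ioc_self ?_
  rw [closure_Ioo hT.ne]
  exact Ioc_subset_Icc_self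

/-- `v` behaves like `t^γ` near the origin together with two derivatives: `v` is continuous on
`(0, T]`, twice differentiable on `(0, T)`, and `|v^(k)(t)| ≤ C t^(γ-k)` for `k = 0, 1, 2`. -/
structure PowerRegular (T γ : ℝ) (v : ℝ → ℝ) : Prop where
  cont : ContinuousOn v (Ioc 0 T)
  derivs : ∃ v' v'' : ℝ → ℝ, (∀ t ∈ Ioo 0 T, HasDerivAt v (v' t) t) ∧
    (∀ t ∈ Ioo 0 T, HasDerivAt v' (v'' t) t) ∧
    (∃ C : ℝ, ∀ t ∈ Ioo 0 T, |v t| ≤ C * t ^ γ) ∧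
    (∃ C : ℝ, ∀ t ∈ Ioo 0 T, |v' t| ≤ C * t ^ (γ - 1)) ∧
    (∃ C : ℝ, ∀ t ∈ Ioo 0 T, |v'' t| ≤ C * t ^ (γ - 2))

namespace PowerRegular

theorem powerBounded {T γ : ℝ} {v : ℝ → ℝ} (hv : PowerRegular T γ v) : PowerBounded T γ v := by
  obtain ⟨_, _, _, _, h, _⟩ := hv.derivs
  exact ⟨hv.cont.mono Ioo_subset_Ioc_self, h⟩

theorem of_le {T γ δ : ℝ} {v : ℝ → ℝ} (hv : PowerRegular T γ v) (h : δ ≤ γ) :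
    PowerRegular T δ v := by
  obtain ⟨v', v'', h1, h2, b0, b1, b2⟩ := hv.derivs
  exact ⟨hv.cont, v', v'', h1, h2, exists_rpow_bound_of_le h b0,
    exists_rpow_bound_of_le (by linarith) b1, exists_rpow_bound_of_le (by linarith) b2⟩

theorem add {T γ : ℝ} {v w : ℝ → ℝ} (hv : PowerRegular T γ v) (hw : PowerRegular T γ w) :
    PowerRegular T γ (fun t => v t + w t) := by
  obtain ⟨v', v'', h1, h2, b0, b1, b2⟩ := hv.derivs
  obtain ⟨w', w'', k1, k2, c0, c1, c2⟩ := hw.derivs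
  exact ⟨hv.cont.add hw.cont, fun t => v' t + w' t, fun t => v'' t + w'' t,
    fun t ht => (h1 t ht).add (k1 t ht), fun t ht => (h2 t ht).add (k2 t ht),
    exists_rpow_bound_add b0 c0, exists_rpow_bound_add b1 c1, exists_rpow_bound_add b2 c2⟩

theorem const_mul {T γ : ℝ} {v : ℝ → ℝ} (c : ℝ) (hv : PowerRegular T γ v) :
    PowerRegular T γ (fun t => c * v t) := by
  obtain ⟨v', v'', h1, h2, b0, b1, b2⟩ := hv.derivs
  exact ⟨continuousOn_const.mul hv.cont, fun t => c * v' t, fun t => c * v'' t,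
    fun t ht => (h1 t ht).const_mul c, fun t ht => (h2 t ht).const_mul c,
    exists_rpow_bound_const_mul c b0, exists_rpow_bound_const_mul c b1,
    exists_rpow_bound_const_mul c b2⟩

theorem congr {T γ : ℝ} {v w : ℝ → ℝ} (hv : PowerRegular T γ v) (h : EqOn w v (Ioc 0 T)) :
    PowerRegular T γ w := by
  obtain ⟨v', v'', h1, h2, ⟨C, hC⟩, b1, b2⟩ := hv.derivs
  refine ⟨hv.cont.congr h, v', v'', fun t ht => (h1 t ht).congr_of_eventuallyEq ?_, h2,
    ⟨C, fun t ht => ?_⟩, b1, b2⟩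
  · filter_upwards [Ioo_mem_nhds ht.1 ht.2] with x hx using h (Ioo_subset_Ioc_self hx)
  · rw [h (Ioo_subset_Ioc_self ht)]
    exact hC t ht

theorem zero (T γ : ℝ) : PowerRegular T γ (fun _ => 0) :=
  ⟨continuousOn_const, fun _ => 0, fun _ => 0, fun t _ => hasDerivAt_const t 0,
    fun t _ => hasDerivAt_const t 0, ⟨0, by simp⟩, ⟨0, by simp⟩, ⟨0, by simp⟩⟩

/-- The fractional integral raises the exponent by its order and preserves two derivatives. -/
theorem fracIntegral {T γ ν : ℝ} {v : ℝ → ℝ} (hν : 0 < ν) (hγ : -1 < γ)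
    (hv : PowerRegular T γ v) : PowerRegular T (γ + ν) (MSD.fracIntegral ν v) := by
  refine ⟨continuousOn_fracIntegral hν hγ hv.powerBounded, ?_⟩
  obtain ⟨v', v'', h1, h2, b0, b1, b2⟩ := hv.derivs
  have hv' : PowerBounded T (γ - 1) v' :=
    ⟨fun t ht => (h2 t ht).continuousAt.continuousWithinAt, b1⟩
  have e0 : -1 < γ + ((0 : ℕ) : ℝ) := by simpa using hγ
  have e1 : -1 < (γ - 1) + ((0 + 1 : ℕ) : ℝ) := by push_cast; linarith
  have e2 : -1 < (γ - 2) + ((0 + 1 + 1 : ℕ) : ℝ) := by push_cast; linarith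
  have b2' : ∃ C : ℝ, ∀ t ∈ Ioo 0 T, |v'' t| ≤ C * t ^ (γ - 1 - 1) := by
    rwa [show γ - 1 - 1 = γ - 2 by ring]
  set H0 := scaledIntegral ν 0 v with hH0
  set H1 := scaledIntegral ν (0 + 1) v' with hH1
  set H2 := scaledIntegral ν (0 + 1 + 1) v'' with hH2
  have d0 : ∀ t ∈ Ioo 0 T, HasDerivAt H0 (H1 t) t := fun t ht =>
    hasDerivAt_scaledIntegral hν e0 hv.powerBounded h1 b1 ht
  have d1 : ∀ t ∈ Ioo 0 T, HasDerivAt H1 (H2 t) t := fun t ht =>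
    hasDerivAt_scaledIntegral hν e1 hv' h2 b2' ht
  have restr : ∀ {p : ℝ} {g : ℝ → ℝ}, (∃ C : ℝ, ∀ t ∈ Ioc 0 T, |g t| ≤ C * t ^ p) →
      ∃ C : ℝ, ∀ t ∈ Ioo 0 T, |g t| ≤ C * t ^ p := fun ⟨C, hC⟩ =>
    ⟨C, fun t ht => hC t (Ioo_subset_Ioc_self ht)⟩
  have B0 := restr (abs_scaledIntegral_le hν e0 b0)
  have B1 := restr (abs_scaledIntegral_le hν e1 b1)
  have B2 := restr (abs_scaledIntegral_le hν e2 b2)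
  set c := 1 / Real.Gamma ν with hc
  have hpow : ∀ q : ℝ, ∀ t ∈ Ioo 0 T, HasDerivAt (fun t : ℝ => t ^ q) (q * t ^ (q - 1)) t :=
    fun q t ht => Real.hasDerivAt_rpow_const (Or.inl ht.1.ne')
  refine ⟨fun t => c * ν * t ^ (ν - 1) * H0 t + c * t ^ ν * H1 t,
    fun t => (c * ν * (ν - 1) * t ^ (ν - 2) * H0 t + c * ν * t ^ (ν - 1) * H1 t)
      + (c * ν * t ^ (ν - 1) * H1 t + c * t ^ ν * H2 t), fun t ht => ?_, fun t ht => ?_, ?_, ?_, ?_⟩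
  · have h := (((hpow ν t ht).const_mul c).mul (d0 t ht))
    refine (h.congr_of_eventuallyEq ?_).congr_deriv (by ring)
    filter_upwards [Ioi_mem_nhds ht.1] with x hx
    rw [fracIntegral_eq_scaledIntegral hx]
    simp only [Pi.mul_apply, hc, ← hH0]
    ring
  · have h := (((hpow (ν - 1) t ht).const_mul (c * ν)).mul (d0 t ht)).add
      (((hpow ν t ht).const_mul c).mul (d1 t ht))
    refine h.congr_deriv ?_
    rw [show ν - 1 - 1 = ν - 2 by ring]
    ring
  · exact restr (abs_fracIntegral_le hν hγ hv.powerBounded)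
  · refine exists_rpow_bound_add ?_ ?_
    · rw [show γ + ν - 1 = γ + (ν - 1) by ring]
      exact exists_rpow_bound_rpow_mul _ B0
    · rw [show γ + ν - 1 = γ - 1 + ν by ring]
      exact exists_rpow_bound_rpow_mul _ B1
  · refine exists_rpow_bound_add (exists_rpow_bound_add ?_ ?_) (exists_rpow_bound_add ?_ ?_)
    · rw [show γ + ν - 2 = γ + (ν - 2) by ring]
      exact exists_rpow_bound_rpow_mul _ B0
    · rw [show γ + ν - 2 = γ - 1 + (ν - 1) by ring]
      exact exists_rpow_bound_rpow_mul _ B1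
    · rw [show γ + ν - 2 = γ - 1 + (ν - 1) by ring]
      exact exists_rpow_bound_rpow_mul _ B1
    · rw [show γ + ν - 2 = γ - 2 + ν by ring]
      exact exists_rpow_bound_rpow_mul _ B2

end PowerRegular

theorem PowerBounded.powerRegular_fracIntegral {T p ν : ℝ} {g : ℝ → ℝ} (hν : 2 < ν) (hp : 0 ≤ p)
    (hg : PowerBounded T p g) : PowerRegular T (p + ν) (MSD.fracIntegral ν g) := by
  have h0 : -1 < p := by linarith
  have hk : PowerBounded T (p + (ν - 2)) (MSD.fracIntegral (ν - 2) g) :=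
    hg.fracIntegral (by linarith) h0
  have hk1 := hk.fracIntegral one_pos (by linarith)
  have hk2 := hk1.fracIntegral one_pos (by linarith)
  have hc2 := continuousOn_fracIntegral one_pos (by linarith) hk1
  have key : PowerRegular T (p + ν)
      (MSD.fracIntegral 1 (MSD.fracIntegral 1 (MSD.fracIntegral (ν - 2) g))) := by
    refine ⟨hc2, _, _, fun t ht => hk1.hasDerivAt_fracIntegral_one (by linarith) ht,
      fun t ht => hk.hasDerivAt_fracIntegral_one (by linarith) ht, ?_, ?_, ?_⟩
    · rw [show p + ν = p + (ν - 2) + 1 + 1 by ring]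
      exact hk2.bound
    · rw [show p + ν - 1 = p + (ν - 2) + 1 by ring]
      exact hk1.bound
    · rw [show p + ν - 2 = p + (ν - 2) by ring]
      exact hk.bound
  refine key.congr fun t ht => ?_
  have ht' : t ∈ Icc 0 T := Ioc_subset_Icc_self ht
  rw [hk.fracIntegral_fracIntegral one_pos one_pos (by linarith) ht',
    hg.fracIntegral_fracIntegral (by norm_num) (by linarith) h0 ht']
  congr 1
  ring

/-! ### Regularity of the remainder -/

/-- Applying `I^α` to the equation turns it into the Volterra equation `u = I^α (f - lam u)`. -/
theorem MSD.IsRelaxationSolution.eq_fracIntegral {α T lam : ℝ} {f u : ℝ → ℝ} (hα0 : 0 < α)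
    (hα1 : α < 1) (hu : MSD.IsRelaxationSolution α T lam f u) {t : ℝ} (ht : t ∈ Icc 0 T) :
    u t = MSD.fracIntegral α (fun s => f s - lam * u s) t := by
  rcases ht.1.eq_or_lt with rfl | h0
  · rw [hu.init, fracIntegral_zero]
  have hac : AbsolutelyContinuousOnInterval u 0 t := hu.absCont.mono (by
    rw [uIcc_of_le ht.1, uIcc_of_le (ht.1.trans ht.2)]
    exact Icc_subset_Icc_right ht.2)
  have hint : IntegrableOn (deriv u) (Ioo 0 t) :=
    (intervalIntegrable_iff_integrableOn_Ioo_of_le ht.1).1 hac.intervalIntegrable_deriv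
  have h1 := fracIntegral_fracIntegral (a := α) (b := 1 - α) hα0 (by linarith) h0
    (measurable_deriv u).aestronglyMeasurable (by simpa using hint)
  rw [add_sub_cancel, fracIntegral_one ht.1, ← integral_Ioc_eq_integral_Ioo,
    ← intervalIntegral.integral_of_le ht.1, hac.integral_deriv_eq_sub, hu.init, sub_zero] at h1
  rw [← h1]
  refine fracIntegral_congr ht.1 fun s hs => ?_
  have := hu.eqn s ⟨hs.1, hs.2.le.trans ht.2⟩
  rw [MSD.fracDeriv] at this
  linarith

theorem iterOp_succ (α lam : ℝ) (i : ℕ) (f : ℝ → ℝ) :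
    MSD.iterOp α lam (i + 1) f = fun t => -lam * MSD.fracIntegral α (MSD.iterOp α lam i f) t :=
  Function.iterate_succ_apply' _ _ _

theorem PowerRegular.iterOp {α T lam : ℝ} {f : ℝ → ℝ} (hα : 0 < α) (hf : PowerRegular T 0 f)
    (i : ℕ) : PowerRegular T 0 (MSD.iterOp α lam i f) := by
  induction i with
  | zero => exact hf
  | succ i ih =>
    rw [iterOp_succ]
    exact ((ih.fracIntegral hα (by norm_num)).of_le (by linarith)).const_mul _

theorem PowerRegular.sum_iterOp {α T lam : ℝ} {f : ℝ → ℝ} (hα : 0 < α) (hf : PowerRegular T 0 f)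
    (n : ℕ) : PowerRegular T 0 (fun t => ∑ i ∈ Finset.range n, MSD.iterOp α lam i f t) := by
  induction n with
  | zero => simpa using PowerRegular.zero T 0
  | succ n ih =>
    simp only [Finset.sum_range_succ]
    exact ih.add (hf.iterOp hα n)

/-- Applying `-lam I^α` to the partial sums of the series `∑ (-lam I^α)^i f` shifts them by one
term. -/
theorem neg_mul_fracIntegral_sum_iterOp {α T lam t : ℝ} {f : ℝ → ℝ} (hα : 0 < α)
    (hf : PowerRegular T 0 f) (n : ℕ) (ht : t ∈ Icc 0 T) :
    f t + -lam * MSD.fracIntegral α (fun t => ∑ i ∈ Finset.range n, MSD.iterOp α lam i f t) t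
      = ∑ i ∈ Finset.range (n + 1), MSD.iterOp α lam i f t := by
  induction n with
  | zero =>
    have h0 : MSD.fracIntegral α (fun _ => 0) t = 0 := by simp [MSD.fracIntegral]
    simp [h0, MSD.iterOp]
  | succ n ih =>
    simp only [Finset.sum_range_succ _ n]
    rw [Finset.sum_range_succ _ (n + 1), ← ih, fracIntegral_add (p := 0) hα (by norm_num)
      (hf.sum_iterOp hα n).powerBounded (hf.iterOp hα n).powerBounded ht, iterOp_succ]
    ring

/-- The exact remainder `v_n = u - I^α ∑_{i<n} (-lam I^α)^i f` of the decomposition. -/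
noncomputable def remainder (α lam : ℝ) (n : ℕ) (f u : ℝ → ℝ) (t : ℝ) : ℝ :=
  u t - MSD.singularPart α lam n f t

section Remainder

variable {α T lam : ℝ} {f u : ℝ → ℝ} {n : ℕ}

theorem remainder_zero_index (t : ℝ) : remainder α lam 0 f u t = u t := by
  simp [remainder, MSD.singularPart, MSD.fracIntegral]

theorem remainder_at_zero (hu : MSD.IsRelaxationSolution α T lam f u) :
    remainder α lam n f u 0 = 0 := by
  rw [remainder, MSD.singularPart, fracIntegral_zero, hu.init, sub_zero]

theorem MSD.IsRelaxationSolution.powerBounded (hT : 0 < T)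
    (hu : MSD.IsRelaxationSolution α T lam f u) : PowerBounded T 0 u := by
  refine PowerBounded.of_continuousOn ?_
  simpa [uIcc_of_le hT.le] using hu.absCont.continuousOn

theorem singularPart_powerRegular (hα : 0 < α) (hf : PowerRegular T 0 f) :
    PowerRegular T α (MSD.singularPart α lam n f) := by
  have h := (hf.sum_iterOp (lam := lam) hα n).fracIntegral hα (by norm_num)
  rwa [zero_add] at h

theorem remainder_powerBounded (hα : 0 < α) (hT : 0 < T) (hf : PowerRegular T 0 f)
    (hu : MSD.IsRelaxationSolution α T lam f u) :
    PowerBounded T 0 (remainder α lam n f u) :=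
  (hu.powerBounded hT).sub ((singularPart_powerRegular hα hf).powerBounded.of_le hα.le)

theorem singularPart_succ (hα : 0 < α) (hf : PowerRegular T 0 f) {t : ℝ} (ht : t ∈ Icc 0 T) :
    MSD.singularPart α lam (n + 1) f t = MSD.fracIntegral α f t
      - lam * MSD.fracIntegral α (MSD.singularPart α lam n f) t := by
  have h0 : (-1 : ℝ) < 0 := by norm_num
  have hS : PowerBounded T 0 (MSD.singularPart α lam n f) :=
    (singularPart_powerRegular hα hf).powerBounded.of_le hα.le
  rw [← fracIntegral_const_mul, ← fracIntegral_sub hα h0 hf.powerBounded (hS.const_mul lam) ht]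
  refine fracIntegral_congr ht.1 fun s hs => ?_
  rw [← neg_mul_fracIntegral_sum_iterOp hα hf n ⟨hs.1.le, hs.2.le.trans ht.2⟩, MSD.singularPart]
  ring

theorem remainder_succ (hα0 : 0 < α) (hα1 : α < 1) (hT : 0 < T) (hf : PowerRegular T 0 f)
    (hu : MSD.IsRelaxationSolution α T lam f u) {t : ℝ} (ht : t ∈ Icc 0 T) :
    remainder α lam (n + 1) f u t = -lam * MSD.fracIntegral α (remainder α lam n f u) t := by
  have h0 : (-1 : ℝ) < 0 := by norm_num
  have hS : PowerBounded T 0 (MSD.singularPart α lam n f) :=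
    (singularPart_powerRegular hα0 hf).powerBounded.of_le hα0.le
  have hub := hu.powerBounded hT
  have e1 : MSD.fracIntegral α (remainder α lam n f u) t = MSD.fracIntegral α u t
      - MSD.fracIntegral α (MSD.singularPart α lam n f) t := fracIntegral_sub hα0 h0 hub hS ht
  have e2 := hu.eq_fracIntegral hα0 hα1 ht
  rw [fracIntegral_sub hα0 h0 hf.powerBounded (hub.const_mul lam) ht,
    fracIntegral_const_mul] at e2
  rw [remainder, singularPart_succ hα0 hf ht, e1, e2]
  ring

theorem remainder_eq_fracIntegral (hα0 : 0 < α) (hα1 : α < 1) (hT : 0 < T)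
    (hf : PowerRegular T 0 f) (hu : MSD.IsRelaxationSolution α T lam f u) {t : ℝ}
    (ht : t ∈ Icc 0 T) :
    remainder α lam n f u t = MSD.fracIntegral α
      (fun s => MSD.iterOp α lam n f s - lam * remainder α lam n f u s) t := by
  have h0 : (-1 : ℝ) < 0 := by norm_num
  have hub := hu.powerBounded hT
  rw [remainder, hu.eq_fracIntegral hα0 hα1 ht, MSD.singularPart, ← fracIntegral_sub hα0 h0
    (hf.powerBounded.sub (hub.const_mul lam)) (hf.sum_iterOp hα0 n).powerBounded ht]
  refine fracIntegral_congr ht.1 fun s hs => ?_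
  have h := neg_mul_fracIntegral_sum_iterOp (lam := lam) hα0 hf n ⟨hs.1.le, hs.2.le.trans ht.2⟩
  rw [Finset.sum_range_succ] at h
  rw [remainder, MSD.singularPart]
  linarith

theorem remainder_eq_fracIntegral_mul (hα0 : 0 < α) (hα1 : α < 1) (hT : 0 < T)
    (hf : PowerRegular T 0 f) (hu : MSD.IsRelaxationSolution α T lam f u) {t : ℝ}
    (ht : t ∈ Icc 0 T) :
    remainder α lam (n + 1) f u t
      = (-lam) ^ (n + 1) * MSD.fracIntegral ((n + 1 : ℕ) * α) u t := by
  induction n generalizing t with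
  | zero =>
    rw [remainder_succ hα0 hα1 hT hf hu ht]
    simp only [funext (remainder_zero_index (α := α) (lam := lam) (f := f) (u := u))]
    simp
  | succ n ih =>
    have hn : (0 : ℝ) < (n + 1 : ℕ) * α := by positivity
    rw [remainder_succ hα0 hα1 hT hf hu ht, fracIntegral_congr ht.1 fun s hs =>
      ih ⟨hs.1.le, hs.2.le.trans ht.2⟩, fracIntegral_const_mul,
      (hu.powerBounded hT).fracIntegral_fracIntegral hα0 hn (by norm_num) ht]
    rw [show α + (n + 1 : ℕ) * α = (n + 1 + 1 : ℕ) * α by push_cast; ring]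
    ring

/-- The solution has two derivatives and behaves like `t^α`. A high remainder is `u` integrated more
than twice, hence twice differentiable because `u` is bounded; the difference between `u` and that
remainder is a fractional integral of a regular function. -/
theorem MSD.IsRelaxationSolution.powerRegular (hα0 : 0 < α) (hα1 : α < 1) (hT : 0 < T)
    (hf : PowerRegular T 0 f) (hu : MSD.IsRelaxationSolution α T lam f u) :
    PowerRegular T α u := by
  -- The remainder of order `N + 1` is a multiple of `I^((N + 1) α) u`, of order more than two.
  obtain ⟨N, hN⟩ := exists_nat_gt (2 / α)
  have hN' : 2 < ((N + 1 : ℕ) : ℝ) * α := by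
    rw [div_lt_iff₀ hα0] at hN
    push_cast
    linarith
  have h1 : PowerRegular T 0 (remainder α lam (N + 1) f u) := by
    have := ((hu.powerBounded hT).powerRegular_fracIntegral hN' le_rfl).const_mul
      ((-lam) ^ (N + 1))
    exact (this.of_le (by linarith)).congr fun t ht =>
      remainder_eq_fracIntegral_mul hα0 hα1 hT hf hu (Ioc_subset_Icc_self ht)
  have h2 : PowerRegular T 0 (MSD.singularPart α lam (N + 1) f) :=
    (singularPart_powerRegular hα0 hf).of_le hα0.le
  have h3 : PowerRegular T 0 u := (h1.add h2).congr fun t _ => by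
    simp [remainder]
  have h4 : PowerRegular T 0 (fun s => f s - lam * u s) := by
    simpa [sub_eq_add_neg] using hf.add (h3.const_mul (-lam))
  have h5 := h4.fracIntegral hα0 (by norm_num)
  rw [zero_add] at h5
  exact h5.congr fun t ht => hu.eq_fracIntegral hα0 hα1 (Ioc_subset_Icc_self ht)

/-- Each term removed from the expansion of `u` gains a factor `t^α` at the origin. -/
theorem remainder_powerRegular (hα0 : 0 < α) (hα1 : α < 1) (hT : 0 < T)
    (hf : PowerRegular T 0 f) (hu : MSD.IsRelaxationSolution α T lam f u) :
    PowerRegular T ((n + 1) * α) (remainder α lam n f u) := by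
  induction n with
  | zero =>
    simpa [funext (remainder_zero_index (α := α) (lam := lam) (f := f) (u := u))]
      using hu.powerRegular hα0 hα1 hT hf
  | succ n ih =>
    have h : (-1 : ℝ) < (n + 1) * α := by linarith [show 0 < (n + 1) * α by positivity]
    have h1 := (ih.fracIntegral hα0 h).const_mul (-lam)
    rw [show (((n + 1 : ℕ) : ℝ) + 1) * α = (n + 1) * α + α by push_cast; ring]
    exact h1.congr fun t ht => remainder_succ hα0 hα1 hT hf hu (Ioc_subset_Icc_self ht)

end Remainder

/-- A function that vanishes at the origin and has a derivative with an integrable power singularity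
is the integral of its derivative. -/
theorem eq_fracIntegral_one_of_hasDerivAt {T p t : ℝ} {v v' : ℝ → ℝ} (hp : -1 < p)
    (hv : ContinuousOn v (Icc 0 T)) (hv0 : v 0 = 0) (hd : ∀ t ∈ Ioo 0 T, HasDerivAt v (v' t) t)
    (hv' : PowerBounded T p v') (ht : t ∈ Ioc 0 T) : v t = MSD.fracIntegral 1 v' t := by
  have hi : IntervalIntegrable v' volume 0 t := by
    rw [intervalIntegrable_iff_integrableOn_Ioo_of_le ht.1.le]
    simpa using hv'.integrableOn_fracIntegrand one_pos hp ht
  have h := intervalIntegral.integral_eq_sub_of_hasDerivAt_of_le ht.1.le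
    (hv.mono (Icc_subset_Icc_right ht.2)) (fun s hs => hd s ⟨hs.1, hs.2.trans_le ht.2⟩) hi
  rw [fracIntegral_one ht.1.le, ← integral_Ioc_eq_integral_Ioo,
    ← intervalIntegral.integral_of_le ht.1.le, h, hv0, sub_zero]

theorem PowerRegular.continuousOn_Icc {T γ : ℝ} {v : ℝ → ℝ} (hγ : 0 < γ)
    (hv : PowerRegular T γ v) (hv0 : v 0 = 0) : ContinuousOn v (Icc 0 T) := by
  intro t ht
  rcases ht.1.eq_or_lt with rfl | h0
  · obtain ⟨C, hC⟩ := hv.powerBounded.bound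
    rcases ht.2.eq_or_lt with rfl | hT
    · simp
    have hlim : Tendsto (fun t : ℝ => C * t ^ γ) (𝓝[Icc 0 T] 0) (𝓝 0) := by
      have : ContinuousAt (fun t : ℝ => C * t ^ γ) 0 :=
        continuousAt_const.mul (Real.continuousAt_rpow_const 0 γ (Or.inr hγ.le))
      simpa [ContinuousAt, Real.zero_rpow hγ.ne'] using this.mono_left nhdsWithin_le_nhds
    rw [ContinuousWithinAt, hv0]
    refine squeeze_zero_norm' ?_ hlim
    have hm : ∀ᶠ t in 𝓝[Icc 0 T] (0 : ℝ), t ∈ Iio T :=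
      mem_nhdsWithin_of_mem_nhds (Iio_mem_nhds hT)
    filter_upwards [hm, self_mem_nhdsWithin] with s hs hs'
    rcases hs'.1.eq_or_lt with rfl | h1
    · simp [hv0, Real.zero_rpow hγ.ne']
    · exact hC s ⟨h1, hs⟩
  · refine (hv.cont t ⟨h0, ht.2⟩).mono_of_mem_nhdsWithin ?_
    filter_upwards [self_mem_nhdsWithin, mem_nhdsWithin_of_mem_nhds (Ioi_mem_nhds h0)] with s hs hs'
    exact ⟨hs', hs.2⟩

/-- `I^α` is inverted by the fractional derivative, pointwise up to the endpoint `T`. -/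
theorem fracIntegral_deriv_of_eq_fracIntegral {α γ T : ℝ} {v v' g : ℝ → ℝ} (hα0 : 0 < α)
    (hα1 : α < 1) (hγ : 0 < γ) (hT : 0 < T) (hv : ContinuousOn v (Icc 0 T)) (hv0 : v 0 = 0)
    (hd : ∀ t ∈ Ioo 0 T, HasDerivAt v (v' t) t) (hv' : PowerBounded T (γ - 1) v')
    (hg : PowerBounded T 0 g) (hgc : ContinuousOn g (Ioc 0 T))
    (H : ∀ t ∈ Icc 0 T, v t = MSD.fracIntegral α g t) :
    EqOn (MSD.fracIntegral (1 - α) v') g (Ioc 0 T) := by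
  have hγ1 : -1 < γ - 1 := by linarith
  have hα2 : 0 < 1 - α := by linarith
  have hk := hv'.fracIntegral hα2 hγ1
  -- Both sides have the same integral over each `(0, t)`, because
  -- `I^1 I^(1-α) v' = I^(1-α) v = I^(1-α) I^α g = I^1 g`.
  have hp : -1 < min (γ - 1 + (1 - α)) 0 := lt_min (by linarith) (by norm_num)
  refine eqOn_of_fracIntegral_one_eqOn hT hp (hk.of_le (min_le_left _ _))
    (hg.of_le (min_le_right _ _)) (continuousOn_fracIntegral hα2 hγ1 hv') hgc fun t ht => ?_
  have ht' : t ∈ Icc 0 T := Ioo_subset_Icc_self ht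
  have e1 : MSD.fracIntegral (1 - α) v t = MSD.fracIntegral (1 - α) (MSD.fracIntegral 1 v') t :=
    fracIntegral_congr ht'.1 fun s hs =>
      eq_fracIntegral_one_of_hasDerivAt hγ1 hv hv0 hd hv' ⟨hs.1, hs.2.le.trans ht'.2⟩
  have e2 : MSD.fracIntegral (1 - α) v t = MSD.fracIntegral (1 - α) (MSD.fracIntegral α g) t :=
    fracIntegral_congr ht'.1 fun s hs => H s ⟨hs.1.le, hs.2.le.trans ht'.2⟩
  rw [hv'.fracIntegral_fracIntegral one_pos hα2 hγ1 ht', add_comm,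
    ← hv'.fracIntegral_fracIntegral hα2 one_pos hγ1 ht', ← e1, e2,
    hg.fracIntegral_fracIntegral hα2 hα0 (by norm_num) ht', sub_add_cancel]

theorem powerRegular_of_hasDerivWithinAt {T σ σ' C : ℝ} {f f' f'' : ℝ → ℝ} (hσ : σ < 1)
    (hσ' : σ' < 1)
    (hf' : ∀ t ∈ Icc 0 T, HasDerivWithinAt f (f' t) (Icc 0 T) t)
    (hf'' : ∀ t ∈ Ioc 0 T, HasDerivWithinAt f' (f'' t) (Icc 0 T) t)
    (hbound' : ∀ t ∈ Ioc 0 T, |f' t| ≤ C * t ^ (-σ))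
    (hbound'' : ∀ t ∈ Ioc 0 T, |f'' t| ≤ C * t ^ (-σ')) : PowerRegular T 0 f := by
  have hc : ContinuousOn f (Icc 0 T) := fun t ht => (hf' t ht).continuousWithinAt
  refine ⟨hc.mono Ioc_subset_Icc_self, f', f'', fun t ht => ?_, fun t ht => ?_,
    (PowerBounded.of_continuousOn hc).bound, ?_, ?_⟩
  · exact (hf' t (Ioo_subset_Icc_self ht)).hasDerivAt (Icc_mem_nhds ht.1 ht.2)
  · exact (hf'' t (Ioo_subset_Ioc_self ht)).hasDerivAt (Icc_mem_nhds ht.1 ht.2)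
  · exact exists_rpow_bound_of_le (p := -σ) (by linarith)
      ⟨C, fun t ht => hbound' t (Ioo_subset_Ioc_self ht)⟩
  · exact exists_rpow_bound_of_le (p := -σ') (by linarith)
      ⟨C, fun t ht => hbound'' t (Ioo_subset_Ioc_self ht)⟩

/-! ### The graded mesh -/

section Mesh

variable {T r : ℝ} {M : ℕ}

theorem meshParam_pos (hT : 0 < T) (hM : 1 ≤ M) : 0 < MSD.meshParam T r M := by
  have : (0 : ℝ) < M := by exact_mod_cast hM
  exact div_pos (Real.rpow_pos_of_pos hT _) this

theorem node_zero (hr : 1 ≤ r) : MSD.node T r M 0 = 0 := by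
  simp [MSD.node, Real.zero_rpow (by linarith : r ≠ 0)]

theorem node_eq_mul (hT : 0 < T) (hM : 1 ≤ M) (k : ℕ) :
    MSD.node T r M k = (k : ℝ) ^ r * MSD.meshParam T r M ^ r := by
  rw [MSD.node, Real.mul_rpow (Nat.cast_nonneg k) (meshParam_pos hT hM).le]

theorem node_last (hT : 0 < T) (hr : 1 ≤ r) (hM : 1 ≤ M) : MSD.node T r M M = T := by
  have h0 : (M : ℝ) ≠ 0 := by positivity
  rw [MSD.node, MSD.meshParam, mul_div_cancel₀ _ h0, ← Real.rpow_mul hT.le,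
    one_div_mul_cancel (by linarith), Real.rpow_one]

theorem node_strictMono (hT : 0 < T) (hr : 1 ≤ r) (hM : 1 ≤ M) :
    StrictMono (MSD.node T r M) := by
  intro j k hjk
  have h := meshParam_pos (r := r) hT hM
  have hjk' : (j : ℝ) < k := by exact_mod_cast hjk
  exact Real.rpow_lt_rpow (by positivity) (by gcongr) (by linarith)

theorem node_nonneg (hT : 0 < T) (hM : 1 ≤ M) (k : ℕ) : 0 ≤ MSD.node T r M k := by
  have := meshParam_pos (r := r) hT hM
  rw [MSD.node]
  positivity

theorem node_pos (hT : 0 < T) (hM : 1 ≤ M) {k : ℕ} (hk : 1 ≤ k) : 0 < MSD.node T r M k := by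
  have := meshParam_pos (r := r) hT hM
  rw [MSD.node]
  positivity

theorem node_le (hT : 0 < T) (hr : 1 ≤ r) (hM : 1 ≤ M) {k : ℕ} (hk : k ≤ M) :
    MSD.node T r M k ≤ T := by
  conv_rhs => rw [← node_last hT hr hM]
  exact (node_strictMono hT hr hM).monotone hk

theorem meshStep_pos (hT : 0 < T) (hr : 1 ≤ r) (hM : 1 ≤ M) (k : ℕ) :
    0 < MSD.meshStep T r M k :=
  sub_pos.2 (node_strictMono hT hr hM k.lt_succ_self)

/-- Convexity of the grading: the last step is at least the average step. -/
theorem node_succ_le_mul_meshStep (hT : 0 < T) (hr : 1 ≤ r) (hM : 1 ≤ M) (k : ℕ) :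
    MSD.node T r M (k + 1) ≤ (k + 1) * MSD.meshStep T r M k := by
  have hτ := meshParam_pos (r := r) hT hM
  have h : (k + 1) * MSD.node T r M k ≤ k * MSD.node T r M (k + 1) := by
    rcases Nat.eq_zero_or_pos k with rfl | hk
    · simp [node_zero hr]
    have hk' : (0 : ℝ) < k := by exact_mod_cast hk
    rw [node_eq_mul hT hM, node_eq_mul hT hM]
    have h1 : (k : ℝ) ^ r = k * (k : ℝ) ^ (r - 1) := by
      rw [Real.rpow_sub_one hk'.ne']
      field_simp
    have h2 : ((k + 1 : ℕ) : ℝ) ^ r = (k + 1) * ((k + 1 : ℕ) : ℝ) ^ (r - 1) := by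
      rw [Real.rpow_sub_one (by positivity)]
      push_cast
      field_simp
    have h3 : (k : ℝ) ^ (r - 1) ≤ ((k + 1 : ℕ) : ℝ) ^ (r - 1) :=
      Real.rpow_le_rpow hk'.le (by push_cast; linarith) (by linarith)
    rw [h1, h2]
    have h4 : 0 ≤ MSD.meshParam T r M ^ r := by positivity
    calc ((k : ℝ) + 1) * (k * (k : ℝ) ^ (r - 1) * MSD.meshParam T r M ^ r)
        = (k * (k + 1) * MSD.meshParam T r M ^ r) * (k : ℝ) ^ (r - 1) := by ring
      _ ≤ (k * (k + 1) * MSD.meshParam T r M ^ r) * ((k + 1 : ℕ) : ℝ) ^ (r - 1) := by gcongr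
      _ = _ := by ring
  rw [MSD.meshStep]
  linarith

/-- Bernoulli's inequality bounds the relative step size by `r / (k + 1)`. -/
theorem mul_meshStep_le (hT : 0 < T) (hr : 1 ≤ r) (hM : 1 ≤ M) (k : ℕ) :
    (k + 1) * MSD.meshStep T r M k ≤ r * MSD.node T r M (k + 1) := by
  have hk : (0 : ℝ) < k + 1 := by positivity
  have hs : (-1 : ℝ) ≤ -(1 / (k + 1)) := by
    rw [neg_le_neg_iff, div_le_one hk]
    linarith [show (0 : ℝ) ≤ k from Nat.cast_nonneg k]
  have h := one_add_mul_self_le_rpow_one_add hs hr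
  have e : 1 + -(1 / ((k : ℝ) + 1)) = k / (k + 1) := by field_simp; ring
  rw [e, Real.div_rpow (Nat.cast_nonneg k) hk.le] at h
  have hp : 0 < ((k : ℝ) + 1) ^ r := Real.rpow_pos_of_pos hk _
  have h' : (((k : ℝ) + 1) - r) * ((k : ℝ) + 1) ^ r ≤ (k + 1) * (k : ℝ) ^ r := by
    rw [le_div_iff₀ hp] at h
    have := mul_le_mul_of_nonneg_left h hk.le
    calc _ = ((k : ℝ) + 1) * ((1 + r * -(1 / (k + 1))) * ((k : ℝ) + 1) ^ r) := by
          field_simp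
          ring
      _ ≤ _ := this
  rw [MSD.meshStep, node_eq_mul hT hM, node_eq_mul hT hM]
  have h4 : 0 ≤ MSD.meshParam T r M ^ r :=
    Real.rpow_nonneg (meshParam_pos hT hM).le _
  have := mul_le_mul_of_nonneg_right h' h4
  push_cast
  linarith

theorem meshStep_le (hT : 0 < T) (hr : 1 ≤ r) (hM : 1 ≤ M) {k : ℕ} (hk : k < M) :
    MSD.meshStep T r M k ≤ r * T / M := by
  have hM0 : (0 : ℝ) < M := by positivity
  have hτ := meshParam_pos (r := r) hT hM
  have hk0 : (0 : ℝ) < (k + 1 : ℕ) := by positivity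
  have h1 := mul_meshStep_le hT hr hM k
  have h2 : M * MSD.node T r M (k + 1) ≤ (k + 1 : ℕ) * T := by
    suffices h : M * MSD.node T r M (k + 1) ≤ (k + 1 : ℕ) * MSD.node T r M M by
      rwa [node_last hT hr hM] at h
    rw [node_eq_mul hT hM, node_eq_mul hT hM]
    have e : ∀ x : ℝ, 0 < x → x ^ r = x * x ^ (r - 1) := fun x hx => by
      rw [Real.rpow_sub_one hx.ne']
      field_simp
    rw [e _ hk0, e _ hM0]
    have h3 : ((k + 1 : ℕ) : ℝ) ^ (r - 1) ≤ (M : ℝ) ^ (r - 1) :=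
      Real.rpow_le_rpow hk0.le (by exact_mod_cast hk) (by linarith)
    have h4 : 0 ≤ MSD.meshParam T r M ^ r := by positivity
    calc _ = (M * (k + 1 : ℕ) * MSD.meshParam T r M ^ r) * ((k + 1 : ℕ) : ℝ) ^ (r - 1) := by ring
      _ ≤ (M * (k + 1 : ℕ) * MSD.meshParam T r M ^ r) * (M : ℝ) ^ (r - 1) := by gcongr
      _ = _ := by ring
  push_cast at h2 hk0
  rw [le_div_iff₀ hM0]
  refine le_of_mul_le_mul_left ?_ hk0
  calc _ = M * ((k + 1) * MSD.meshStep T r M k) := by ring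
    _ ≤ M * (r * MSD.node T r M (k + 1)) := by gcongr
    _ = r * (M * MSD.node T r M (k + 1)) := by ring
    _ ≤ r * ((k + 1) * T) := by gcongr
    _ = _ := by ring

theorem node_succ_le_two_rpow_mul (hT : 0 < T) (hr : 1 ≤ r) (hM : 1 ≤ M) {k : ℕ} (hk : 1 ≤ k) :
    MSD.node T r M (k + 1) ≤ 2 ^ r * MSD.node T r M k := by
  have hτ := meshParam_pos (r := r) hT hM
  have hk' : (1 : ℝ) ≤ k := by exact_mod_cast hk
  rw [MSD.node, MSD.node, ← Real.mul_rpow (by norm_num) (by positivity)]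
  refine Real.rpow_le_rpow (by positivity) ?_ (by linarith)
  push_cast
  nlinarith

theorem node_half_le (hT : 0 < T) (hr : 1 ≤ r) (hM : 1 ≤ M) (m : ℕ) :
    MSD.node T r M (m / 2) ≤ MSD.node T r M m / 2 := by
  have hτ := meshParam_pos (r := r) hT hM
  have h1 : ((m / 2 : ℕ) : ℝ) ≤ (m : ℝ) * (1 / 2) := by
    have := @Nat.cast_div_le ℝ _ _ _ m 2
    push_cast at this
    linarith
  rw [MSD.node, MSD.node]
  calc _ ≤ ((1 / 2) * (m * MSD.meshParam T r M)) ^ r := by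
        refine Real.rpow_le_rpow (by positivity) ?_ (by linarith)
        nlinarith
    _ = (1 / 2) ^ r * (m * MSD.meshParam T r M) ^ r := Real.mul_rpow (by norm_num) (by positivity)
    _ ≤ (1 / 2) * (m * MSD.meshParam T r M) ^ r := by
        refine mul_le_mul_of_nonneg_right ?_ (by positivity)
        conv_rhs => rw [← Real.rpow_one (1 / 2 : ℝ)]
        exact Real.rpow_le_rpow_of_exponent_ge (by norm_num) (by norm_num) hr
    _ = _ := by ring

theorem node_rpow (hT : 0 < T) (hM : 1 ≤ M) (γ : ℝ) (k : ℕ) :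
    MSD.node T r M k ^ γ = (k : ℝ) ^ (r * γ) * MSD.meshParam T r M ^ (r * γ) := by
  have hτ := meshParam_pos (r := r) hT hM
  rw [node_eq_mul hT hM, Real.mul_rpow (by positivity) (by positivity),
    ← Real.rpow_mul (by positivity), ← Real.rpow_mul hτ.le]

/-- The scale of the interpolation error of a function of type `t^γ` on the interval number `k`. The
restriction `r γ ≤ 2 - α` makes the bound uniform. -/
theorem meshStep_sq_mul_node_rpow_le {α γ : ℝ} (hT : 0 < T) (hr : 1 ≤ r) (hM : 1 ≤ M)
    (hγ : γ ≤ 2) (hrγ : r * γ ≤ 2 - α) {k : ℕ} (hk : 1 ≤ k) :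
    MSD.meshStep T r M k ^ 2 * MSD.node T r M k ^ (γ - 2)
      ≤ r ^ 2 * (2 ^ r) ^ (2 - γ) * (MSD.meshParam T r M ^ (r * γ) * ((k : ℝ) + 1) ^ (-α)) := by
  have hτ := meshParam_pos (r := r) hT hM
  have hk1 : (1 : ℝ) ≤ k + 1 := by linarith [show (0 : ℝ) ≤ k from Nat.cast_nonneg k]
  have hn0 := node_pos (r := r) hT hM hk
  have hn := node_pos (r := r) hT hM (Nat.le_add_left 1 k)
  have h2 : (0 : ℝ) < 2 ^ r := by positivity
  have h1 : MSD.node T r M k ^ (γ - 2)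
      ≤ (2 ^ r) ^ (2 - γ) * MSD.node T r M (k + 1) ^ (γ - 2) := by
    have h3 : MSD.node T r M (k + 1) / 2 ^ r ≤ MSD.node T r M k := by
      rw [div_le_iff₀ h2, mul_comm]
      exact node_succ_le_two_rpow_mul hT hr hM hk
    have h4 := Real.rpow_le_rpow_of_nonpos (by positivity) h3 (show γ - 2 ≤ 0 by linarith)
    rw [Real.div_rpow hn.le h2.le, ← neg_sub 2 γ, Real.rpow_neg h2.le (2 - γ), div_inv_eq_mul,
      neg_sub, mul_comm] at h4
    exact h4
  have h5 : MSD.meshStep T r M k ≤ r * MSD.node T r M (k + 1) / (k + 1) := by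
    rw [le_div_iff₀ (by positivity), mul_comm]
    exact mul_meshStep_le hT hr hM k
  have hstep := meshStep_pos hT hr hM k
  have h6 : ((k : ℝ) + 1) ^ (r * γ - 2) ≤ ((k : ℝ) + 1) ^ (-α) :=
    Real.rpow_le_rpow_of_exponent_le hk1 (by linarith)
  have h7 : MSD.node T r M (k + 1) ^ 2 * MSD.node T r M (k + 1) ^ (γ - 2)
      = ((k : ℝ) + 1) ^ (r * γ) * MSD.meshParam T r M ^ (r * γ) := by
    rw [← Real.rpow_natCast, ← Real.rpow_add hn]
    have := node_rpow (r := r) hT hM γ (k + 1)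
    push_cast at this ⊢
    rw [← this]
    congr 1
    ring
  have h8 : ((k : ℝ) + 1) ^ (r * γ - 2) = ((k : ℝ) + 1) ^ (r * γ) / ((k : ℝ) + 1) ^ 2 := by
    rw [Real.rpow_sub (by positivity)]
    norm_num
  calc _ ≤ (r * MSD.node T r M (k + 1) / (k + 1)) ^ 2 *
        ((2 ^ r) ^ (2 - γ) * MSD.node T r M (k + 1) ^ (γ - 2)) := by gcongr
    _ = r ^ 2 * (2 ^ r) ^ (2 - γ) * ((MSD.node T r M (k + 1) ^ 2 *
        MSD.node T r M (k + 1) ^ (γ - 2)) / (k + 1) ^ 2) := by rw [div_pow]; ring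
    _ = r ^ 2 * (2 ^ r) ^ (2 - γ) *
        (MSD.meshParam T r M ^ (r * γ) * ((k : ℝ) + 1) ^ (r * γ - 2)) := by
      rw [h7, h8]; ring
    _ ≤ _ := by gcongr

theorem step_rpow_neg_le {α : ℝ} (hα : 0 < α) (hT : 0 < T) (hr : 1 ≤ r) (hM : 1 ≤ M) (k : ℕ) :
    ((k : ℝ) + 1) ^ (-α) * MSD.meshStep T r M k ^ (-α) ≤ MSD.node T r M (k + 1) ^ (-α) := by
  have hs := meshStep_pos hT hr hM k
  rw [← Real.mul_rpow (by positivity) hs.le]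
  exact Real.rpow_le_rpow_of_nonpos (node_pos hT hM (Nat.le_add_left 1 k))
    (node_succ_le_mul_meshStep hT hr hM k) (by linarith)

/-- The increments of the kernel `(t_m - s)^(-α)` over the mesh, damped by `(k + 1)^(-α)`, sum to a
multiple of `t_m^(-α)`: in the first half of the mesh the kernel is of that size, in the second half
the damping compensates the size of the kernel one step before `t_m`. -/
theorem sum_weighted_kernel_increments_le {α : ℝ} (hα : 0 < α) (hT : 0 < T) (hr : 1 ≤ r)
    (hM : 1 ≤ M) (m : ℕ) :
    ∑ k ∈ Finset.range m, ((k : ℝ) + 1) ^ (-α) *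
      ((MSD.node T r M (m + 1) - MSD.node T r M (k + 1)) ^ (-α)
        - (MSD.node T r M (m + 1) - MSD.node T r M k) ^ (-α))
      ≤ 2 * 2 ^ α * MSD.node T r M (m + 1) ^ (-α) := by
  set t := MSD.node T r M with ht
  set φ : ℕ → ℝ := fun k => (t (m + 1) - t k) ^ (-α) with hφ
  have hmono := node_strictMono hT hr hM
  have hinc : ∀ k ∈ Finset.range m, 0 ≤ φ (k + 1) - φ k := fun k hk => by
    rw [Finset.mem_range] at hk
    have h1 : t k < t (k + 1) := hmono k.lt_succ_self
    have h2 : t (k + 1) < t (m + 1) := hmono (by omega)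
    exact sub_nonneg.2 (Real.rpow_le_rpow_of_nonpos (by linarith) (by linarith) (by linarith))
  have hφ0 : ∀ k ≤ m + 1, 0 ≤ φ k := fun k hk =>
    Real.rpow_nonneg (sub_nonneg.2 (hmono.monotone hk)) _
  have hm0 : (0 : ℝ) < m + 1 := by positivity
  -- The weight is at most `1` in the first half and at most `((m + 1) / 2) ^ (-α)` in the second.
  have hw : ∀ k ∈ Finset.range m, ((k : ℝ) + 1) ^ (-α) * (φ (k + 1) - φ k)
      ≤ (if k < (m + 1) / 2 then φ (k + 1) - φ k else 0)
        + (((m : ℝ) + 1) / 2) ^ (-α) * (φ (k + 1) - φ k) := fun k hk => by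
    have h0 := hinc k hk
    have h3 : 0 ≤ (((m : ℝ) + 1) / 2) ^ (-α) := by positivity
    split_ifs with h
    · have : ((k : ℝ) + 1) ^ (-α) ≤ 1 := Real.rpow_le_one_of_one_le_of_nonpos
        (by linarith [show (0 : ℝ) ≤ k from Nat.cast_nonneg k]) (by linarith)
      nlinarith
    · rw [zero_add]
      refine mul_le_mul_of_nonneg_right ?_ h0
      refine Real.rpow_le_rpow_of_nonpos (by positivity) ?_ (by linarith)
      have h4 : m + 1 ≤ 2 * (k + 1) := by omega
      have h5 : ((m : ℝ) + 1) ≤ 2 * (k + 1) := by exact_mod_cast h4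
      linarith
  have htm : 0 < t (m + 1) := node_pos hT hM (Nat.le_add_left 1 m)
  refine (Finset.sum_le_sum hw).trans ?_
  rw [Finset.sum_add_distrib, ← Finset.mul_sum, Finset.sum_range_sub, ← Finset.sum_filter]
  have hfil : (Finset.range m).filter (fun k => k < (m + 1) / 2) = Finset.range ((m + 1) / 2) := by
    ext k
    simp only [Finset.mem_filter, Finset.mem_range]
    omega
  rw [hfil, Finset.sum_range_sub]
  have e2 : (2 : ℝ) ^ α = (1 / 2 : ℝ) ^ (-α) := by
    rw [one_div, Real.inv_rpow (by norm_num), Real.rpow_neg (by norm_num), inv_inv]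
  have b1 : φ ((m + 1) / 2) ≤ 2 ^ α * t (m + 1) ^ (-α) := by
    rw [e2, ← Real.mul_rpow (by norm_num) htm.le]
    refine Real.rpow_le_rpow_of_nonpos (by positivity) ?_ (by linarith)
    have := node_half_le hT hr hM (m + 1)
    rw [← ht] at this
    linarith
  have b2 : (((m : ℝ) + 1) / 2) ^ (-α) * φ m ≤ 2 ^ α * t (m + 1) ^ (-α) := by
    have := step_rpow_neg_le hα hT hr hM m
    rw [e2, div_eq_inv_mul, ← one_div, Real.mul_rpow (by norm_num) hm0.le, mul_assoc]
    refine mul_le_mul_of_nonneg_left this (by positivity)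
  have b3 : 0 ≤ (((m : ℝ) + 1) / 2) ^ (-α) * φ 0 :=
    mul_nonneg (by positivity) (hφ0 0 (by omega))
  have b4 := hφ0 0 (by omega)
  rw [mul_sub]
  linarith

end Mesh

/-! ### Truncation error of the L1 formula -/

theorem abs_intervalIntegral_le_of_Ioo {a b : ℝ} (hab : a ≤ b) {F G : ℝ → ℝ}
    (hG : IntervalIntegrable G volume a b) (h : ∀ s ∈ Ioo a b, |F s| ≤ G s) :
    |∫ s in a..b, F s| ≤ ∫ s in a..b, G s := by
  rw [intervalIntegral.integral_of_le hab, intervalIntegral.integral_of_le hab,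
    integral_Ioc_eq_integral_Ioo, integral_Ioc_eq_integral_Ioo]
  refine norm_integral_le_of_norm_le (f := F)
    ((intervalIntegrable_iff_integrableOn_Ioo_of_le hab).1 hG) ?_
  filter_upwards [ae_restrict_mem measurableSet_Ioo] with s hs using h s hs

theorem intervalIntegrable_kernel {α a b t : ℝ} (hα : α < 1) :
    IntervalIntegrable (fun s => (t - s) ^ (-α)) volume a b := by
  have := (intervalIntegral.intervalIntegrable_rpow' (r := -α) (a := t - a) (b := t - b)
    (by linarith)).comp_sub_left t
  simpa using this

theorem integral_kernel {α a b t : ℝ} (hα : α < 1) :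
    ∫ s in a..b, (t - s) ^ (-α) = ((t - a) ^ (1 - α) - (t - b) ^ (1 - α)) / (1 - α) := by
  rw [intervalIntegral.integral_comp_sub_left (fun x => x ^ (-α)) t,
    integral_rpow (Or.inl (by linarith)), show -α + 1 = 1 - α by ring]

/-- Away from the singularity of the kernel, a function with mean value `d` on `[a, b]` deviates
from `d` in a way that only sees the oscillation of the kernel, because subtracting a constant from
the kernel does not change the integral. -/
theorem abs_integral_sub_mean_mul_kernel_le {α a b t d G : ℝ} {w : ℝ → ℝ} (hα : 0 < α)
    (hab : a < b) (hbt : b < t) (hw : IntervalIntegrable w volume a b)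
    (hd : ∫ s in a..b, w s = d * (b - a)) (hG : ∫ s in a..b, |w s - d| ≤ G) :
    |∫ s in a..b, (w s - d) * (t - s) ^ (-α)| ≤ G * ((t - b) ^ (-α) - (t - a) ^ (-α)) := by
  have hwd : IntervalIntegrable (fun s => w s - d) volume a b := hw.sub intervalIntegrable_const
  have hc : ContinuousOn (fun s => (t - s) ^ (-α)) (uIcc a b) := by
    refine ContinuousOn.rpow_const (by fun_prop) fun s hs => Or.inl ?_
    rw [uIcc_of_le hab.le] at hs
    linarith [hs.2]
  -- The constant subtracted from the kernel is its value at `a`.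
  have h0 : ∫ s in a..b, (w s - d) * (t - a) ^ (-α) = 0 := by
    rw [intervalIntegral.integral_mul_const, intervalIntegral.integral_sub hw
      intervalIntegrable_const, hd, intervalIntegral.integral_const, smul_eq_mul]
    ring
  have h1 : ∫ s in a..b, (w s - d) * (t - s) ^ (-α)
      = ∫ s in a..b, (w s - d) * ((t - s) ^ (-α) - (t - a) ^ (-α)) := by
    simp only [mul_sub]
    rw [intervalIntegral.integral_sub (hwd.mul_continuousOn hc) (hwd.mul_const _), h0, sub_zero]
  have hΔ : 0 ≤ (t - b) ^ (-α) - (t - a) ^ (-α) :=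
    sub_nonneg.2 (Real.rpow_le_rpow_of_nonpos (by linarith) (by linarith) (by linarith))
  rw [h1]
  calc _ ≤ ∫ s in a..b, |w s - d| * ((t - b) ^ (-α) - (t - a) ^ (-α)) := by
        refine abs_intervalIntegral_le_of_Ioo hab.le (hwd.abs.mul_const _) fun s hs => ?_
        have h2 : (t - s) ^ (-α) ≤ (t - b) ^ (-α) :=
          Real.rpow_le_rpow_of_nonpos (by linarith) (by linarith [hs.2]) (by linarith)
        have h3 : (t - a) ^ (-α) ≤ (t - s) ^ (-α) :=
          Real.rpow_le_rpow_of_nonpos (by linarith [hs.2]) (by linarith [hs.1]) (by linarith)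
        rw [abs_mul, abs_of_nonneg (sub_nonneg.2 h3)]
        gcongr
    _ = (∫ s in a..b, |w s - d|) * ((t - b) ^ (-α) - (t - a) ^ (-α)) :=
        intervalIntegral.integral_mul_const _ _
    _ ≤ _ := mul_le_mul_of_nonneg_right hG hΔ

/-- The slope of a chord differs from the derivative on the chord by the length times the largest
second derivative. -/
theorem abs_deriv_sub_slope_le {a b B s : ℝ} {v v' v'' : ℝ → ℝ} (hab : a < b)
    (hv : ContinuousOn v (Icc a b)) (hd : ∀ x ∈ Ioo a b, HasDerivAt v (v' x) x)
    (hd' : ∀ x ∈ Ioo a b, HasDerivAt v' (v'' x) x) (hB : ∀ x ∈ Ioo a b, |v'' x| ≤ B)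
    (hs : s ∈ Ioo a b) : |v' s - (v b - v a) / (b - a)| ≤ B * (b - a) := by
  obtain ⟨ξ, hξ, e⟩ := exists_hasDerivAt_eq_slope v v' hab hv hd
  rw [← e]
  have h := (convex_Ioo a b).norm_image_sub_le_of_norm_hasDerivWithin_le
    (fun x hx => (hd' x hx).hasDerivWithinAt) hB hξ hs
  have hB0 : 0 ≤ B := (abs_nonneg _).trans (hB s hs)
  refine h.trans (mul_le_mul_of_nonneg_left ?_ hB0)
  rw [Real.norm_eq_abs, abs_le]
  constructor <;> linarith [hs.1, hs.2, hξ.1, hξ.2]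

section Truncation

variable {α γ r T C : ℝ} {v v' v'' : ℝ → ℝ} {M : ℕ}

theorem meshInterval_subset (hT : 0 < T) (hr : 1 ≤ r) (hM : 1 ≤ M) {k : ℕ} (hk : k < M) :
    Ioo (MSD.node T r M k) (MSD.node T r M (k + 1)) ⊆ Ioo 0 T := fun _ hs =>
  ⟨(node_nonneg hT hM k).trans_lt hs.1, hs.2.trans_le (node_le hT hr hM hk)⟩

/-- The slope of `v` on the mesh interval number `k`. -/
noncomputable def meshSlope (T r : ℝ) (M : ℕ) (v : ℝ → ℝ) (k : ℕ) : ℝ :=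
  (v (MSD.node T r M (k + 1)) - v (MSD.node T r M k)) / MSD.meshStep T r M k

theorem abs_deriv_sub_meshSlope_le (hT : 0 < T) (hr : 1 ≤ r) (hM : 1 ≤ M)
    (hγ : γ ≤ 2) (hrγ : r * γ ≤ 2 - α) (hC : 0 ≤ C) (hv : ContinuousOn v (Icc 0 T))
    (hd : ∀ t ∈ Ioo 0 T, HasDerivAt v (v' t) t) (hd' : ∀ t ∈ Ioo 0 T, HasDerivAt v' (v'' t) t)
    (h2 : ∀ t ∈ Ioo 0 T, |v'' t| ≤ C * t ^ (γ - 2)) {k : ℕ} (hk1 : 1 ≤ k) (hk : k < M) {s : ℝ}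
    (hs : s ∈ Ioo (MSD.node T r M k) (MSD.node T r M (k + 1))) :
    |v' s - meshSlope T r M v k| ≤ C * (r ^ 2 * (2 ^ r) ^ (2 - γ)) *
      (MSD.meshParam T r M ^ (r * γ) * ((k : ℝ) + 1) ^ (-α)) / MSD.meshStep T r M k := by
  have hsub := meshInterval_subset hT hr hM hk
  have hstep := meshStep_pos hT hr hM k
  have hk0 := node_pos (r := r) hT hM hk1
  have h := abs_deriv_sub_slope_le (B := C * MSD.node T r M k ^ (γ - 2))
    (node_strictMono hT hr hM k.lt_succ_self)
    (hv.mono (Icc_subset_Icc (node_nonneg hT hM k) (node_le hT hr hM hk)))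
    (fun x hx => hd x (hsub hx)) (fun x hx => hd' x (hsub hx)) (fun x hx => ?_) hs
  · rw [meshSlope, le_div_iff₀ hstep]
    have h3 := meshStep_sq_mul_node_rpow_le hT hr hM hγ hrγ hk1
    calc _ ≤ C * MSD.node T r M k ^ (γ - 2) * MSD.meshStep T r M k * MSD.meshStep T r M k :=
          mul_le_mul_of_nonneg_right h hstep.le
      _ = C * (MSD.meshStep T r M k ^ 2 * MSD.node T r M k ^ (γ - 2)) := by ring
      _ ≤ _ := by
          rw [mul_assoc C]
          exact mul_le_mul_of_nonneg_left h3 hC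
  · refine (h2 x (hsub hx)).trans (mul_le_mul_of_nonneg_left ?_ hC)
    exact Real.rpow_le_rpow_of_nonpos hk0 hx.1.le (by linarith)

theorem intervalIntegrable_of_powerBounded {p t : ℝ} (hp : -1 < p) (hv' : PowerBounded T p v')
    (ht : t ∈ Ioc 0 T) : IntervalIntegrable v' volume 0 t := by
  rw [intervalIntegrable_iff_integrableOn_Ioo_of_le ht.1.le]
  simpa using hv'.integrableOn_fracIntegrand one_pos hp ht

theorem integral_deriv_eq_meshSlope_mul (hT : 0 < T) (hr : 1 ≤ r) (hM : 1 ≤ M) (hγ : 0 < γ)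
    (hv : ContinuousOn v (Icc 0 T)) (hd : ∀ t ∈ Ioo 0 T, HasDerivAt v (v' t) t)
    (hv' : PowerBounded T (γ - 1) v') {k : ℕ} (hk : k < M) :
    IntervalIntegrable v' volume (MSD.node T r M k) (MSD.node T r M (k + 1)) ∧
    ∫ s in MSD.node T r M k..MSD.node T r M (k + 1), v' s
      = meshSlope T r M v k * (MSD.node T r M (k + 1) - MSD.node T r M k) := by
  have hsub := meshInterval_subset hT hr hM hk
  have hlt : MSD.node T r M k < MSD.node T r M (k + 1) := node_strictMono hT hr hM k.lt_succ_self
  have hpos := node_pos (r := r) hT hM (Nat.le_add_left 1 k)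
  have hi : IntervalIntegrable v' volume (MSD.node T r M k) (MSD.node T r M (k + 1)) := by
    refine (intervalIntegrable_of_powerBounded (by linarith) hv'
      ⟨hpos, node_le hT hr hM hk⟩).mono_set ?_
    rw [uIcc_of_le hlt.le, uIcc_of_le hpos.le]
    exact Icc_subset_Icc_left (node_nonneg hT hM k)
  refine ⟨hi, ?_⟩
  rw [intervalIntegral.integral_eq_sub_of_hasDerivAt_of_le hlt.le
    (hv.mono (Icc_subset_Icc (node_nonneg hT hM k) (node_le hT hr hM hk)))
    (fun s hs => hd s (hsub hs)) hi, meshSlope, MSD.meshStep, div_mul_cancel₀ _ (sub_pos.2 hlt).ne']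

theorem abs_apply_le_of_deriv_bound {t : ℝ} (hγ : 0 < γ)
    (hv : ContinuousOn v (Icc 0 T)) (hv0 : v 0 = 0) (hd : ∀ t ∈ Ioo 0 T, HasDerivAt v (v' t) t)
    (hv' : PowerBounded T (γ - 1) v') (h1 : ∀ t ∈ Ioo 0 T, |v' t| ≤ C * t ^ (γ - 1))
    (ht : t ∈ Ioc 0 T) : |v t| ≤ C * t ^ γ / γ := by
  have e := intervalIntegral.integral_eq_sub_of_hasDerivAt_of_le ht.1.le
    (hv.mono (Icc_subset_Icc_right ht.2)) (fun s hs => hd s ⟨hs.1, hs.2.trans_le ht.2⟩)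
    (intervalIntegrable_of_powerBounded (by linarith) hv' ht)
  rw [hv0, sub_zero] at e
  rw [← e]
  refine (abs_intervalIntegral_le_of_Ioo ht.1.le
    ((intervalIntegral.intervalIntegrable_rpow' (r := γ - 1) (by linarith)).const_mul C)
    fun s hs => h1 s ⟨hs.1, hs.2.trans_le ht.2⟩).trans (le_of_eq ?_)
  rw [intervalIntegral.integral_const_mul, integral_rpow (Or.inl (by linarith)), sub_add_cancel,
    Real.zero_rpow hγ.ne', sub_zero, mul_div_assoc]

theorem abs_meshSlope_zero_le (hT : 0 < T) (hr : 1 ≤ r) (hM : 1 ≤ M) (hγ : 0 < γ)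
    (hv : ContinuousOn v (Icc 0 T)) (hv0 : v 0 = 0) (hd : ∀ t ∈ Ioo 0 T, HasDerivAt v (v' t) t)
    (hv' : PowerBounded T (γ - 1) v') (h1 : ∀ t ∈ Ioo 0 T, |v' t| ≤ C * t ^ (γ - 1)) :
    |meshSlope T r M v 0| ≤ C / γ * MSD.node T r M 1 ^ (γ - 1) := by
  have hpos := node_pos (r := r) hT hM le_rfl
  have h := abs_apply_le_of_deriv_bound hγ hv hv0 hd hv' h1 ⟨hpos, node_le hT hr hM hM⟩
  rw [meshSlope, MSD.meshStep, zero_add, node_zero hr, hv0, sub_zero, sub_zero, abs_div,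
    abs_of_pos hpos, Real.rpow_sub_one hpos.ne', div_le_iff₀ hpos]
  refine h.trans (le_of_eq ?_)
  field_simp

/-- The `L¹` distance of the derivative from the slope on the mesh interval number `k`. -/
theorem integral_abs_deriv_sub_meshSlope_le (hT : 0 < T) (hr : 1 ≤ r) (hM : 1 ≤ M)
    (hγ0 : 0 < γ) (hγ : γ ≤ 2) (hrγ : r * γ ≤ 2 - α) (hC : 0 ≤ C)
    (hv : ContinuousOn v (Icc 0 T)) (hv0 : v 0 = 0)
    (hd : ∀ t ∈ Ioo 0 T, HasDerivAt v (v' t) t) (hd' : ∀ t ∈ Ioo 0 T, HasDerivAt v' (v'' t) t)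
    (hv' : PowerBounded T (γ - 1) v') (h1 : ∀ t ∈ Ioo 0 T, |v' t| ≤ C * t ^ (γ - 1))
    (h2 : ∀ t ∈ Ioo 0 T, |v'' t| ≤ C * t ^ (γ - 2)) {k : ℕ} (hk : k < M) :
    ∫ s in MSD.node T r M k..MSD.node T r M (k + 1), |v' s - meshSlope T r M v k|
      ≤ (2 * C / γ + C * (r ^ 2 * (2 ^ r) ^ (2 - γ))) *
        (MSD.meshParam T r M ^ (r * γ) * ((k : ℝ) + 1) ^ (-α)) := by
  have hτ := meshParam_pos (r := r) hT hM
  have hlt : MSD.node T r M k < MSD.node T r M (k + 1) := node_strictMono hT hr hM k.lt_succ_self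
  have hstep := meshStep_pos hT hr hM k
  have hA : 0 ≤ MSD.meshParam T r M ^ (r * γ) * ((k : ℝ) + 1) ^ (-α) := by positivity
  have hsub := meshInterval_subset hT hr hM hk
  have hK1 : 0 ≤ 2 * C / γ := by positivity
  have hK2 : 0 ≤ C * (r ^ 2 * (2 ^ r) ^ (2 - γ)) := by positivity
  refine (le_abs_self _).trans ?_
  -- The first interval contains the singularity of `v` where only `v'` need be integrable.
  rcases Nat.eq_zero_or_pos k with rfl | hk1
  · have hpos := node_pos (r := r) hT hM le_rfl
    have hslope := abs_meshSlope_zero_le hT hr hM hγ0 hv hv0 hd hv' h1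
    have hi : IntervalIntegrable (fun s => C * s ^ (γ - 1)) volume 0 (MSD.node T r M 1) :=
      (intervalIntegral.intervalIntegrable_rpow' (by linarith)).const_mul C
    have e : MSD.node T r M 1 ^ γ = MSD.meshParam T r M ^ (r * γ) := by
      rw [node_rpow hT hM]; simp
    simp only [zero_add, node_zero hr] at hsub hlt ⊢
    have key := abs_intervalIntegral_le_of_Ioo hpos.le
      (F := fun s => |v' s - meshSlope T r M v 0|)
      (hi.add (intervalIntegrable_const (c := C / γ * MSD.node T r M 1 ^ (γ - 1))))
      fun s hs => by
        rw [abs_abs]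
        exact (abs_sub _ _).trans (add_le_add (h1 s (hsub hs)) hslope)
    refine key.trans ?_
    rw [intervalIntegral.integral_add hi intervalIntegrable_const,
      intervalIntegral.integral_const_mul, integral_rpow (Or.inl (by linarith)), sub_add_cancel,
      Real.zero_rpow hγ0.ne', intervalIntegral.integral_const, smul_eq_mul,
      Real.rpow_sub_one hpos.ne', e, Nat.cast_zero, zero_add, Real.one_rpow, mul_one]
    have hAp : 0 ≤ MSD.meshParam T r M ^ (r * γ) := by positivity
    calc _ = 2 * C / γ * MSD.meshParam T r M ^ (r * γ) := by field_simp; ring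
      _ ≤ _ := by
        refine mul_le_mul_of_nonneg_right ?_ hAp
        linarith
  · have key := abs_intervalIntegral_le_of_Ioo hlt.le
      (F := fun s => |v' s - meshSlope T r M v k|)
      (G := fun _ => C * (r ^ 2 * (2 ^ r) ^ (2 - γ)) *
      (MSD.meshParam T r M ^ (r * γ) * ((k : ℝ) + 1) ^ (-α)) / MSD.meshStep T r M k)
      intervalIntegrable_const
      fun s hs => by
        rw [abs_abs]
        exact abs_deriv_sub_meshSlope_le hT hr hM hγ hrγ hC hv hd hd' h2 hk1 hk hs
    refine key.trans ?_
    rw [intervalIntegral.integral_const, smul_eq_mul, ← MSD.meshStep, mul_div_cancel₀ _ hstep.ne']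
    refine mul_le_mul_of_nonneg_right ?_ hA
    linarith

/-- The contribution of the interval that touches the singularity of the kernel. -/
theorem abs_last_contribution_le (hα0 : 0 < α) (hα1 : α < 1) (hT : 0 < T) (hr : 1 ≤ r)
    (hM : 1 ≤ M) (hγ0 : 0 < γ) (hγ : γ ≤ 2) (hrγ : r * γ ≤ 2 - α) (hC : 0 ≤ C)
    (hv : ContinuousOn v (Icc 0 T)) (hv0 : v 0 = 0)
    (hd : ∀ t ∈ Ioo 0 T, HasDerivAt v (v' t) t) (hd' : ∀ t ∈ Ioo 0 T, HasDerivAt v' (v'' t) t)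
    (hv' : PowerBounded T (γ - 1) v') (h1 : ∀ t ∈ Ioo 0 T, |v' t| ≤ C * t ^ (γ - 1))
    (h2 : ∀ t ∈ Ioo 0 T, |v'' t| ≤ C * t ^ (γ - 2)) {k : ℕ} (hk : k < M) :
    |∫ s in MSD.node T r M k..MSD.node T r M (k + 1),
        (v' s - meshSlope T r M v k) * (MSD.node T r M (k + 1) - s) ^ (-α)|
      ≤ (C * (Real.Gamma (1 - α) * Real.Gamma γ / Real.Gamma (1 - α + γ))
          + C / γ / (1 - α) + C * (r ^ 2 * (2 ^ r) ^ (2 - γ)) / (1 - α)) *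
        (MSD.meshParam T r M ^ (r * γ) * MSD.node T r M (k + 1) ^ (-α)) := by
  have hτ := meshParam_pos (r := r) hT hM
  have hlt : MSD.node T r M k < MSD.node T r M (k + 1) := node_strictMono hT hr hM k.lt_succ_self
  have hstep := meshStep_pos hT hr hM k
  have hpos' := node_pos (r := r) hT hM (Nat.le_add_left 1 k)
  have hA : 0 ≤ MSD.meshParam T r M ^ (r * γ) * MSD.node T r M (k + 1) ^ (-α) := by positivity
  have hsub := meshInterval_subset hT hr hM hk
  have hα2 : 0 < 1 - α := by linarith
  have hΓ1 := Real.Gamma_pos_of_pos hα2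
  have hΓ2 := Real.Gamma_pos_of_pos hγ0
  have hΓ3 := Real.Gamma_pos_of_pos (add_pos hα2 hγ0)
  have hK1 : 0 ≤ C * (Real.Gamma (1 - α) * Real.Gamma γ / Real.Gamma (1 - α + γ)) := by positivity
  have hK2 : 0 ≤ C / γ / (1 - α) := by positivity
  have hK3 : 0 ≤ C * (r ^ 2 * (2 ^ r) ^ (2 - γ)) / (1 - α) := by positivity
  rcases Nat.eq_zero_or_pos k with rfl | hk1
  · have hpos := node_pos (r := r) hT hM le_rfl
    have hslope := abs_meshSlope_zero_le hT hr hM hγ0 hv hv0 hd hv' h1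
    have e : MSD.node T r M 1 ^ γ = MSD.meshParam T r M ^ (r * γ) := by
      rw [node_rpow hT hM]; simp
    simp only [zero_add, node_zero hr] at hsub hlt ⊢
    set t := MSD.node T r M 1 with ht
    have hb := integral_beta_kernel hα2 hγ0 hpos
    have hbi := integrableOn_beta_kernel hα2 hγ0 hpos
    simp only [sub_zero, show 1 - α - 1 = -α by ring] at hb hbi
    rw [← integral_Ioc_eq_integral_Ioo, ← intervalIntegral.integral_of_le hpos.le] at hb
    have hbi' := ((intervalIntegrable_iff_integrableOn_Ioo_of_le hpos.le).2 hbi).const_mul C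
    have hki := (intervalIntegrable_kernel (a := 0) (b := t) (t := t) hα1).const_mul
      (C / γ * t ^ (γ - 1))
    have key := abs_intervalIntegral_le_of_Ioo hpos.le
      (F := fun s => (v' s - meshSlope T r M v 0) * (t - s) ^ (-α)) (hbi'.add hki)
      fun s hs => by
        have h3 : 0 ≤ (t - s) ^ (-α) := Real.rpow_nonneg (by linarith [hs.2]) _
        rw [abs_mul, abs_of_nonneg h3]
        calc _ ≤ (C * s ^ (γ - 1) + C / γ * t ^ (γ - 1)) * (t - s) ^ (-α) :=
              mul_le_mul_of_nonneg_right
                ((abs_sub _ _).trans (add_le_add (h1 s (hsub hs)) hslope)) h3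
          _ = _ := by ring
    refine key.trans ?_
    rw [intervalIntegral.integral_add hbi' hki, intervalIntegral.integral_const_mul, hb,
      intervalIntegral.integral_const_mul, integral_kernel hα1, sub_zero, sub_self,
      Real.zero_rpow hα2.ne', sub_zero, ← e, show 1 - α + γ - 1 = γ + -α by ring,
      show 1 - α = 1 + -α by ring, Real.rpow_add hpos, Real.rpow_add hpos, Real.rpow_one,
      Real.rpow_sub_one hpos.ne']
    rw [← e, show 1 - α = 1 + -α by ring] at *
    have hX : 0 ≤ t ^ γ * t ^ (-α) := by positivity
    calc _ = (C * (Real.Gamma (1 + -α) * Real.Gamma γ / Real.Gamma (1 + -α + γ))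
          + C / γ / (1 + -α)) * (t ^ γ * t ^ (-α)) := by field_simp
      _ ≤ _ := by
        refine mul_le_mul_of_nonneg_right ?_ hX
        linarith
  · set t := MSD.node T r M (k + 1) with ht
    set D := C * (r ^ 2 * (2 ^ r) ^ (2 - γ)) *
      (MSD.meshParam T r M ^ (r * γ) * ((k : ℝ) + 1) ^ (-α)) / MSD.meshStep T r M k with hD
    have key := abs_intervalIntegral_le_of_Ioo hlt.le
      (F := fun s => (v' s - meshSlope T r M v k) * (t - s) ^ (-α))
      (G := fun s => D * (t - s) ^ (-α))
      ((intervalIntegrable_kernel hα1).const_mul D)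
      fun s hs => by
        have h3 : 0 ≤ (t - s) ^ (-α) := Real.rpow_nonneg (by linarith [hs.2]) _
        rw [abs_mul, abs_of_nonneg h3]
        exact mul_le_mul_of_nonneg_right
          (abs_deriv_sub_meshSlope_le hT hr hM hγ hrγ hC hv hd hd' h2 hk1 hk hs) h3
    refine key.trans ?_
    rw [intervalIntegral.integral_const_mul, integral_kernel hα1, sub_self,
      Real.zero_rpow hα2.ne', sub_zero, ht, ← MSD.meshStep, ← ht]
    have h4 := step_rpow_neg_le hα0 hT hr hM k
    rw [← ht] at h4
    have hpw : MSD.meshStep T r M k ^ (1 - α)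
        = MSD.meshStep T r M k * MSD.meshStep T r M k ^ (-α) := by
      rw [sub_eq_add_neg, Real.rpow_add hstep, Real.rpow_one]
    calc _ = C * (r ^ 2 * (2 ^ r) ^ (2 - γ)) / (1 - α) * (MSD.meshParam T r M ^ (r * γ) *
          (((k : ℝ) + 1) ^ (-α) * MSD.meshStep T r M k ^ (-α))) := by
            rw [hpw, hD]; field_simp
      _ ≤ C * (r ^ 2 * (2 ^ r) ^ (2 - γ)) / (1 - α) *
          (MSD.meshParam T r M ^ (r * γ) * t ^ (-α)) := by gcongr
      _ ≤ _ := by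
        refine mul_le_mul_of_nonneg_right ?_ hA
        linarith

/-- The truncation error is the integral of `v' - (slope)` against the kernel. -/
theorem truncation_error_eq (hα1 : α < 1) (hT : 0 < T) (hr : 1 ≤ r) (hM : 1 ≤ M)
    (hγ : 0 < γ) (hv' : PowerBounded T (γ - 1) v') {m : ℕ} (hm : m + 1 ≤ M) :
    MSD.fracIntegral (1 - α) v' (MSD.node T r M (m + 1))
        - MSD.l1Deriv α T r M (fun k => v (MSD.node T r M k)) (m + 1)
      = 1 / Real.Gamma (1 - α) * ∑ k ∈ Finset.range (m + 1),
        ∫ s in MSD.node T r M k..MSD.node T r M (k + 1),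
          (v' s - meshSlope T r M v k) * (MSD.node T r M (m + 1) - s) ^ (-α) := by
  have hα2 : 0 < 1 - α := by linarith
  set t := MSD.node T r M (m + 1) with ht
  have hpos : 0 < t := node_pos hT hM (Nat.le_add_left 1 m)
  have hint := hv'.integrableOn_fracIntegrand hα2 (by linarith) ⟨hpos, node_le hT hr hM hm⟩
  rw [show 1 - α - 1 = -α by ring,
    ← intervalIntegrable_iff_integrableOn_Ioo_of_le hpos.le] at hint
  have hmono := (node_strictMono hT hr hM).monotone
  have hintk : ∀ k < m + 1, IntervalIntegrable (fun s => v' s * (t - s) ^ (-α)) volume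
      (MSD.node T r M k) (MSD.node T r M (k + 1)) := fun k hk => by
    refine hint.mono_set ?_
    rw [uIcc_of_le (hmono k.le_succ), uIcc_of_le hpos.le]
    exact Icc_subset_Icc (node_nonneg hT hM k) (hmono hk)
  have e1 : MSD.fracIntegral (1 - α) v' t = 1 / Real.Gamma (1 - α) *
      ∑ k ∈ Finset.range (m + 1), ∫ s in MSD.node T r M k..MSD.node T r M (k + 1),
        v' s * (t - s) ^ (-α) := by
    rw [intervalIntegral.sum_integral_adjacent_intervals hintk, node_zero hr,
      fracIntegral_eq_setIntegral hpos.le, intervalIntegral.integral_of_le hpos.le,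
      integral_Ioc_eq_integral_Ioo, show 1 - α - 1 = -α by ring]
  have e2 : MSD.l1Deriv α T r M (fun k => v (MSD.node T r M k)) (m + 1)
      = 1 / Real.Gamma (1 - α) * ∑ k ∈ Finset.range (m + 1),
        ∫ s in MSD.node T r M k..MSD.node T r M (k + 1), meshSlope T r M v k * (t - s) ^ (-α) := by
    have hΓ := Real.Gamma_pos_of_pos hα2
    rw [MSD.l1Deriv, show 2 - α = (1 - α) + 1 by ring, Real.Gamma_add_one hα2.ne',
      Finset.mul_sum, Finset.mul_sum]
    refine Finset.sum_congr rfl fun k _ => ?_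
    rw [intervalIntegral.integral_const_mul, integral_kernel hα1, meshSlope, ← ht]
    field_simp
  rw [e1, e2, ← mul_sub, ← Finset.sum_sub_distrib]
  congr 1
  refine Finset.sum_congr rfl fun k hk => ?_
  rw [← intervalIntegral.integral_sub (hintk k (Finset.mem_range.1 hk))
    ((intervalIntegrable_kernel hα1).const_mul _)]
  congr 1
  ext s
  ring

/-- The truncation error of the L1 formula for a function of type `t^γ` is at most a multiple of
`τ^(rγ) t_m^(-α)`, provided that `r γ ≤ 2 - α`. -/
theorem exists_truncation_error_bound (hα0 : 0 < α) (hα1 : α < 1) (hT : 0 < T) (hr : 1 ≤ r)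
    (hγ0 : 0 < γ) (hrγ : r * γ ≤ 2 - α) (hv : ContinuousOn v (Icc 0 T)) (hv0 : v 0 = 0)
    (hd : ∀ t ∈ Ioo 0 T, HasDerivAt v (v' t) t) (hd' : ∀ t ∈ Ioo 0 T, HasDerivAt v' (v'' t) t)
    (h1 : ∃ C : ℝ, ∀ t ∈ Ioo 0 T, |v' t| ≤ C * t ^ (γ - 1))
    (h2 : ∃ C : ℝ, ∀ t ∈ Ioo 0 T, |v'' t| ≤ C * t ^ (γ - 2)) :
    ∃ K : ℝ, 0 ≤ K ∧ ∀ M : ℕ, 1 ≤ M → ∀ m : ℕ, m + 1 ≤ M →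
      |MSD.fracIntegral (1 - α) v' (MSD.node T r M (m + 1))
          - MSD.l1Deriv α T r M (fun k => v (MSD.node T r M k)) (m + 1)|
        ≤ K * (MSD.meshParam T r M ^ (r * γ) * MSD.node T r M (m + 1) ^ (-α)) := by
  have hγ : γ ≤ 2 := by nlinarith
  have hv' : PowerBounded T (γ - 1) v' :=
    ⟨fun t ht => (hd' t ht).continuousAt.continuousWithinAt, h1⟩
  obtain ⟨C₁, hC₁⟩ := h1
  obtain ⟨C₂, hC₂⟩ := h2
  set C := max |C₁| |C₂| with hCdef
  have hC : 0 ≤ C := (abs_nonneg _).trans (le_max_left _ _)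
  have h1 : ∀ t ∈ Ioo 0 T, |v' t| ≤ C * t ^ (γ - 1) := fun t ht => (hC₁ t ht).trans <|
    mul_le_mul_of_nonneg_right ((le_abs_self _).trans (le_max_left _ _))
      (Real.rpow_nonneg ht.1.le _)
  have h2 : ∀ t ∈ Ioo 0 T, |v'' t| ≤ C * t ^ (γ - 2) := fun t ht => (hC₂ t ht).trans <|
    mul_le_mul_of_nonneg_right ((le_abs_self _).trans (le_max_right _ _))
      (Real.rpow_nonneg ht.1.le _)
  have hα2 : 0 < 1 - α := by linarith
  have hΓ1 := Real.Gamma_pos_of_pos hα2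
  have hΓ2 := Real.Gamma_pos_of_pos hγ0
  have hΓ3 := Real.Gamma_pos_of_pos (add_pos hα2 hγ0)
  set K₁ := 2 * C / γ + C * (r ^ 2 * (2 ^ r) ^ (2 - γ)) with hK₁
  set K₂ := C * (Real.Gamma (1 - α) * Real.Gamma γ / Real.Gamma (1 - α + γ))
          + C / γ / (1 - α) + C * (r ^ 2 * (2 ^ r) ^ (2 - γ)) / (1 - α) with hK₂
  have hK₁0 : 0 ≤ K₁ := by positivity
  have hK₂0 : 0 ≤ K₂ := by positivity
  refine ⟨1 / Real.Gamma (1 - α) * (K₁ * (2 * 2 ^ α) + K₂), by positivity, fun M hM m hm => ?_⟩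
  have hτ := meshParam_pos (r := r) hT hM
  set t := MSD.node T r M (m + 1) with ht
  set A := MSD.meshParam T r M ^ (r * γ) with hA
  have hA0 : 0 ≤ A := by positivity
  have hmono := node_strictMono hT hr hM
  rw [truncation_error_eq hα1 hT hr hM hγ0 hv' hm, abs_mul,
    abs_of_nonneg (by positivity : 0 ≤ 1 / Real.Gamma (1 - α)), mul_assoc]
  refine mul_le_mul_of_nonneg_left ?_ (by positivity)
  rw [Finset.sum_range_succ]
  refine (abs_add_le _ _).trans ?_
  rw [add_mul]
  refine add_le_add ?_ (abs_last_contribution_le hα0 hα1 hT hr hM hγ0 hγ hrγ hC hv hv0 hd hd' hv'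
    h1 h2 hm)
  refine (Finset.abs_sum_le_sum_abs _ _).trans ?_
  calc _ ≤ ∑ k ∈ Finset.range m, K₁ * A * (((k : ℝ) + 1) ^ (-α) *
          ((t - MSD.node T r M (k + 1)) ^ (-α) - (t - MSD.node T r M k) ^ (-α))) := by
        refine Finset.sum_le_sum fun k hk => ?_
        rw [Finset.mem_range] at hk
        obtain ⟨hi, hmean⟩ := integral_deriv_eq_meshSlope_mul hT hr hM hγ0 hv hd hv'
          (show k < M by omega)
        refine (abs_integral_sub_mean_mul_kernel_le hα0 (hmono k.lt_succ_self)
          (hmono (by omega : k + 1 < m + 1)) hi hmean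
          (integral_abs_deriv_sub_meshSlope_le hT hr hM hγ0 hγ hrγ hC hv hv0 hd hd' hv' h1 h2
            (show k < M by omega))).trans (le_of_eq ?_)
        rw [← ht]
        ring
    _ = K₁ * A * ∑ k ∈ Finset.range m, ((k : ℝ) + 1) ^ (-α) *
          ((t - MSD.node T r M (k + 1)) ^ (-α) - (t - MSD.node T r M k) ^ (-α)) := by
        rw [Finset.mul_sum]
    _ ≤ K₁ * A * (2 * 2 ^ α * t ^ (-α)) :=
        mul_le_mul_of_nonneg_left (sum_weighted_kernel_increments_le hα0 hT hr hM m) (by positivity)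
    _ = _ := by ring

end Truncation

/-! ### Stability and convergence of the L1 scheme -/

section Scheme

variable {α T lam r : ℝ} {M : ℕ}

/-- The coefficient of the increment `V^(k+1) - V^k` in the L1 formula at `t_m`. -/
noncomputable def l1Coeff (α T r : ℝ) (M m k : ℕ) : ℝ :=
  1 / Real.Gamma (2 - α) *
    (((MSD.node T r M m - MSD.node T r M k) ^ (1 - α)
      - (MSD.node T r M m - MSD.node T r M (k + 1)) ^ (1 - α)) / MSD.meshStep T r M k)

theorem l1Deriv_eq_sum (V : ℕ → ℝ) (m : ℕ) :
    MSD.l1Deriv α T r M V m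
      = ∑ k ∈ Finset.range m, (V (k + 1) - V k) * l1Coeff α T r M m k := by
  rw [MSD.l1Deriv, Finset.mul_sum]
  refine Finset.sum_congr rfl fun k _ => ?_
  rw [l1Coeff]
  ring

theorem l1Deriv_linear (a b : ℝ) (V W : ℕ → ℝ) (m : ℕ) :
    MSD.l1Deriv α T r M (fun k => a * V k + b * W k) m
      = a * MSD.l1Deriv α T r M V m + b * MSD.l1Deriv α T r M W m := by
  simp only [l1Deriv_eq_sum, Finset.mul_sum, ← Finset.sum_add_distrib]
  exact Finset.sum_congr rfl fun k _ => by ring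

theorem l1Deriv_const_mul (a : ℝ) (V : ℕ → ℝ) (m : ℕ) :
    MSD.l1Deriv α T r M (fun k => a * V k) m = a * MSD.l1Deriv α T r M V m := by
  have h := l1Deriv_linear (α := α) (T := T) (r := r) (M := M) a 0 V V m
  simpa using h

theorem l1Deriv_sub (V W : ℕ → ℝ) (m : ℕ) :
    MSD.l1Deriv α T r M (fun k => V k - W k) m
      = MSD.l1Deriv α T r M V m - MSD.l1Deriv α T r M W m := by
  have h := l1Deriv_linear (α := α) (T := T) (r := r) (M := M) 1 (-1) V W m
  simpa [← sub_eq_add_neg] using h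

theorem l1Coeff_diag (hα1 : α < 1) (hT : 0 < T) (hr : 1 ≤ r) (hM : 1 ≤ M) (m : ℕ) :
    l1Coeff α T r M (m + 1) m = MSD.meshStep T r M m ^ (-α) / Real.Gamma (2 - α) := by
  have hs := meshStep_pos hT hr hM m
  rw [l1Coeff, sub_self, Real.zero_rpow (by linarith), sub_zero, ← MSD.meshStep,
    sub_eq_add_neg 1 α, Real.rpow_add hs, Real.rpow_one]
  field_simp

/-- By concavity of `x^(1-α)`, the coefficients increase towards the diagonal. -/
theorem l1Coeff_le_succ (hα0 : 0 < α) (hα1 : α < 1) (hT : 0 < T) (hr : 1 ≤ r) (hM : 1 ≤ M)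
    {m k : ℕ} (hk : k + 2 ≤ m) : l1Coeff α T r M m k ≤ l1Coeff α T r M m (k + 1) := by
  have hmono := node_strictMono (r := r) hT hr hM
  have h1 : MSD.node T r M k < MSD.node T r M (k + 1) := hmono k.lt_succ_self
  have h2 : MSD.node T r M (k + 1) < MSD.node T r M (k + 2) := hmono (k + 1).lt_succ_self
  have h3 : MSD.node T r M (k + 2) ≤ MSD.node T r M m := hmono.monotone hk
  have hc := Real.concaveOn_rpow (p := 1 - α) (by linarith) (by linarith)
  have h := hc.slope_anti_adjacent (x := MSD.node T r M m - MSD.node T r M (k + 2))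
    (y := MSD.node T r M m - MSD.node T r M (k + 1)) (z := MSD.node T r M m - MSD.node T r M k)
    (mem_Ici.2 (by linarith)) (mem_Ici.2 (by linarith)) (by linarith) (by linarith)
  have hΓ := Real.Gamma_pos_of_pos (show 0 < 2 - α by linarith)
  rw [l1Coeff, l1Coeff, MSD.meshStep, MSD.meshStep]
  refine mul_le_mul_of_nonneg_left ?_ (by positivity)
  convert h using 2 <;> ring

theorem mul_rpow_neg_le_rpow_sub_rpow {y z : ℝ} (hα0 : 0 < α) (hα1 : α < 1) (hy : 0 ≤ y)
    (hyz : y < z) : (1 - α) * z ^ (-α) * (z - y) ≤ z ^ (1 - α) - y ^ (1 - α) := by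
  have hz : 0 < z := hy.trans_lt hyz
  have hs : -1 ≤ -((z - y) / z) := by
    rw [neg_le_neg_iff, div_le_one hz]
    linarith
  have h := rpow_one_add_le_one_add_mul_self hs (p := 1 - α) (by linarith) (by linarith)
  have e : 1 + -((z - y) / z) = y / z := by field_simp; ring
  have e2 : z ^ (1 - α) = z * z ^ (-α) := by
    rw [sub_eq_add_neg, Real.rpow_add hz, Real.rpow_one]
  rw [e, Real.div_rpow hy hz.le, div_le_iff₀ (Real.rpow_pos_of_pos hz _)] at h
  have e3 : (1 + (1 - α) * -((z - y) / z)) * z ^ (1 - α)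
      = z ^ (1 - α) - (1 - α) * z ^ (-α) * (z - y) := by
    rw [e2]
    field_simp
    ring
  linarith

theorem kernel_div_Gamma_le_l1Coeff (hα0 : 0 < α) (hα1 : α < 1) (hT : 0 < T) (hr : 1 ≤ r)
    (hM : 1 ≤ M) {m k : ℕ} (hk : k + 1 ≤ m) :
    (MSD.node T r M m - MSD.node T r M k) ^ (-α) / Real.Gamma (1 - α) ≤ l1Coeff α T r M m k := by
  have hmono := node_strictMono (r := r) hT hr hM
  have h1 : MSD.node T r M k < MSD.node T r M (k + 1) := hmono k.lt_succ_self
  have h3 : MSD.node T r M (k + 1) ≤ MSD.node T r M m := hmono.monotone hk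
  have h := mul_rpow_neg_le_rpow_sub_rpow hα0 hα1 (y := MSD.node T r M m - MSD.node T r M (k + 1))
    (z := MSD.node T r M m - MSD.node T r M k) (by linarith) (by linarith)
  have hα2 : 0 < 1 - α := by linarith
  have hΓ := Real.Gamma_pos_of_pos hα2
  have hs := meshStep_pos hT hr hM k
  rw [l1Coeff, show 2 - α = (1 - α) + 1 by ring, Real.Gamma_add_one hα2.ne']
  have e : MSD.node T r M m - MSD.node T r M k - (MSD.node T r M m - MSD.node T r M (k + 1))
      = MSD.meshStep T r M k := by
    rw [MSD.meshStep]
    ring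
  rw [e, ← le_div_iff₀ hs] at h
  calc _ = 1 / ((1 - α) * Real.Gamma (1 - α)) *
        ((1 - α) * (MSD.node T r M m - MSD.node T r M k) ^ (-α)) := by field_simp
    _ ≤ _ := mul_le_mul_of_nonneg_left h (by positivity)

/-- Summation by parts against an increasing nonnegative weight, for a sequence that is nonnegative
up to its last term. -/
theorem sum_sub_mul_le {c z : ℕ → ℝ} {m : ℕ} (hc0 : 0 ≤ c 0)
    (hc : ∀ k, k + 1 ≤ m → c k ≤ c (k + 1)) (hz : ∀ k ≤ m, 0 ≤ z k) :
    ∑ k ∈ Finset.range (m + 1), (z (k + 1) - z k) * c k ≤ c m * z (m + 1) := by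
  have key : ∀ j ≤ m, ∑ k ∈ Finset.range (j + 1), (z (k + 1) - z k) * c k ≤ c j * z (j + 1) := by
    intro j
    induction j with
    | zero =>
      intro _
      rw [zero_add, Finset.sum_range_one]
      nlinarith [hz 0 (Nat.zero_le m)]
    | succ j ih =>
      intro hj
      rw [Finset.sum_range_succ]
      have := ih (by omega)
      nlinarith [hz (j + 1) hj, hc j hj]
  exact key m le_rfl

theorem l1Coeff_nonneg (hα0 : 0 < α) (hα1 : α < 1) (hT : 0 < T) (hr : 1 ≤ r)
    (hM : 1 ≤ M) {m k : ℕ} (hk : k + 1 ≤ m) : 0 ≤ l1Coeff α T r M m k := by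
  refine le_trans ?_ (kernel_div_Gamma_le_l1Coeff hα0 hα1 hT hr hM hk)
  have hΓ := Real.Gamma_pos_of_pos (show 0 < 1 - α by linarith)
  have := (node_strictMono (r := r) hT hr hM).monotone (show k ≤ m by omega)
  exact div_nonneg (Real.rpow_nonneg (sub_nonneg.2 this) _) hΓ.le

/-- The discrete maximum principle for `D_M^α + lam`. -/
theorem nonneg_of_l1Deriv_add_nonneg (hα0 : 0 < α) (hα1 : α < 1) (hT : 0 < T) (hr : 1 ≤ r)
    (hM : 1 ≤ M) (hdiag : ∀ m, m < M → 0 < l1Coeff α T r M (m + 1) m + lam) {z : ℕ → ℝ}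
    (hz0 : 0 ≤ z 0)
    (hz : ∀ m, m < M → 0 ≤ MSD.l1Deriv α T r M z (m + 1) + lam * z (m + 1)) :
    ∀ m ≤ M, 0 ≤ z m := by
  intro m
  induction m using Nat.strong_induction_on with
  | _ m ih =>
    intro hm
    rcases m with _ | m
    · exact hz0
    have h := sum_sub_mul_le (c := l1Coeff α T r M (m + 1)) (z := z) (m := m)
      (l1Coeff_nonneg hα0 hα1 hT hr hM (by omega))
      (fun k hk => l1Coeff_le_succ hα0 hα1 hT hr hM (by omega))
      (fun k hk => ih k (by omega) (by omega))
    have h1 := hz m hm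
    rw [l1Deriv_eq_sum] at h1
    have h2 := hdiag m hm
    have h3 : 0 ≤ (l1Coeff α T r M (m + 1) m + lam) * z (m + 1) := by
      rw [add_mul]
      linarith
    exact nonneg_of_mul_nonneg_right h3 h2

theorem abs_le_of_abs_l1Deriv_add_le (hα0 : 0 < α) (hα1 : α < 1) (hT : 0 < T) (hr : 1 ≤ r)
    (hM : 1 ≤ M) (hdiag : ∀ m, m < M → 0 < l1Coeff α T r M (m + 1) m + lam) {e B : ℕ → ℝ}
    (h0 : |e 0| ≤ B 0)
    (h : ∀ m, m < M → |MSD.l1Deriv α T r M e (m + 1) + lam * e (m + 1)|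
      ≤ MSD.l1Deriv α T r M B (m + 1) + lam * B (m + 1)) :
    ∀ m ≤ M, |e m| ≤ B m := by
  intro m hm
  -- The maximum principle is applied to `B + e` and to `B - e`.
  have h1 : ∀ s : ℝ, |s| = 1 → 0 ≤ 1 * B m + s * e m := by
    intro s hs
    have hle : ∀ x y : ℝ, |x| ≤ y → 0 ≤ y + s * x := fun x y hxy => by
      have := neg_abs_le (s * x)
      rw [abs_mul, hs, one_mul] at this
      linarith
    refine nonneg_of_l1Deriv_add_nonneg (z := fun k => 1 * B k + s * e k) hα0 hα1 hT hr hM hdiag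
      ?_ (fun k hk => ?_) m hm
    · simpa using hle _ _ h0
    · have := hle _ _ (h k hk)
      rw [l1Deriv_linear]
      linarith
  have a := h1 1 (by simp)
  have b := h1 (-1) (by simp)
  rw [abs_le]
  constructor <;> linarith

/-- The barrier of the stability estimate: the jump from `0` to `1` at the first node produces the
term `t_m^(-α)`, and the exponential growth absorbs the reaction term. -/
noncomputable def barrier (κ T r : ℝ) (M k : ℕ) : ℝ :=
  if k = 0 then 0 else Real.exp (κ * MSD.node T r M k)

theorem barrier_monotone {κ : ℝ} (hκ : 0 < κ) (hT : 0 < T) (hr : 1 ≤ r) (hM : 1 ≤ M) :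
    Monotone (barrier κ T r M) := by
  intro j k hjk
  rw [barrier, barrier]
  split_ifs with h1 h2 h2
  · exact le_rfl
  · positivity
  · omega
  · have := (node_strictMono (r := r) hT hr hM).monotone hjk
    gcongr

theorem kernel_le_l1Deriv_barrier {κ : ℝ} (hκ : 0 < κ) (hα0 : 0 < α) (hα1 : α < 1) (hT : 0 < T)
    (hr : 1 ≤ r) (hM : 1 ≤ M) (m : ℕ) :
    MSD.node T r M (m + 1) ^ (-α) / Real.Gamma (1 - α)
      ≤ MSD.l1Deriv α T r M (barrier κ T r M) (m + 1) := by
  have hΓ := Real.Gamma_pos_of_pos (show 0 < 1 - α by linarith)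
  have hpos := node_pos (r := r) hT hM (Nat.le_add_left 1 m)
  have hmono := barrier_monotone hκ hT hr hM
  have hc : ∀ k ∈ Finset.range (m + 1), 0 ≤ l1Coeff α T r M (m + 1) k := fun k hk =>
    l1Coeff_nonneg hα0 hα1 hT hr hM (by rw [Finset.mem_range] at hk; omega)
  rw [l1Deriv_eq_sum]
  refine le_trans ?_ (Finset.single_le_sum (f := fun k => (barrier κ T r M (k + 1)
    - barrier κ T r M k) * l1Coeff α T r M (m + 1) k) (fun k hk => mul_nonneg
      (sub_nonneg.2 (hmono k.le_succ)) (hc k hk)) (Finset.mem_range.2 m.succ_pos))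
  have h1 := kernel_div_Gamma_le_l1Coeff hα0 hα1 hT hr hM (show 0 + 1 ≤ m + 1 by omega)
  rw [node_zero hr, sub_zero] at h1
  have h2 : 1 ≤ barrier κ T r M (0 + 1) - barrier κ T r M 0 := by
    have := node_pos (r := r) hT hM le_rfl
    simp only [barrier, zero_add, one_ne_zero, if_false, if_true, sub_zero]
    exact Real.one_le_exp (by positivity)
  have h3 := hc 0 (Finset.mem_range.2 m.succ_pos)
  nlinarith

/-- On the window of length `1 / κ` before `t_m` the kernel is at least `κ^α`, and a fixed fraction
of the height of the barrier at `t_m` is gained there. -/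
theorem mul_barrier_le_l1Deriv_barrier {κ : ℝ} (hκ : 0 < κ) (hα0 : 0 < α) (hα1 : α < 1)
    (hT : 0 < T) (hr : 1 ≤ r) (hM : 1 ≤ M)
    (hstep : ∀ k, k < M → κ * MSD.meshStep T r M k ≤ 1 / 2) {m : ℕ} (hm : m < M) :
    κ ^ α / Real.Gamma (1 - α) * ((1 - Real.exp (-(1 / 2))) * barrier κ T r M (m + 1))
      ≤ MSD.l1Deriv α T r M (barrier κ T r M) (m + 1) := by
  have hΓ := Real.Gamma_pos_of_pos (show 0 < 1 - α by linarith)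
  have hmono := barrier_monotone hκ hT hr hM
  have hnode := node_strictMono (r := r) hT hr hM
  set B := barrier κ T r M with hB
  have hB1 : B (m + 1) = Real.exp (κ * MSD.node T r M (m + 1)) := by simp [hB, barrier]
  set θ := Real.exp (-(1 / 2)) * B (m + 1) with hθ
  have hB0 : B 0 = 0 := by simp [hB, barrier]
  have hθ0 : 0 ≤ θ := by rw [hθ, hB1]; positivity
  have hθ1 : θ ≤ B (m + 1) := by
    have : Real.exp (-(1 / 2)) ≤ 1 := Real.exp_le_one_iff.2 (by norm_num)
    have h0 : 0 ≤ B (m + 1) := by rw [hB1]; positivity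
    nlinarith
  -- Truncating the barrier below at `θ` leaves only increments inside the window, and the
  -- truncated increments telescope.
  have htel : κ ^ α / Real.Gamma (1 - α) * ((1 - Real.exp (-(1 / 2))) * B (m + 1))
      = ∑ k ∈ Finset.range (m + 1),
        (max (B (k + 1)) θ - max (B k) θ) * (κ ^ α / Real.Gamma (1 - α)) := by
    rw [← Finset.sum_mul, Finset.sum_range_sub (fun k => max (B k) θ), hB0, max_eq_right hθ0,
      max_eq_left hθ1, hθ]
    ring
  rw [htel, l1Deriv_eq_sum]
  refine Finset.sum_le_sum fun k hk => ?_
  rw [Finset.mem_range] at hk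
  have hinc : B k ≤ B (k + 1) := hmono k.le_succ
  have hc := l1Coeff_nonneg (r := r) hα0 hα1 hT hr hM (show k + 1 ≤ m + 1 by omega)
  rcases le_or_gt (B (k + 1)) θ with h | h
  · rw [max_eq_right h, max_eq_right (hinc.trans h), sub_self, zero_mul]
    exact mul_nonneg (sub_nonneg.2 hinc) hc
  · have h1 : κ * MSD.node T r M (m + 1) - 1 / 2 < κ * MSD.node T r M (k + 1) := by
      have e : B (k + 1) = Real.exp (κ * MSD.node T r M (k + 1)) := by simp [hB, barrier]
      rw [hθ, hB1, e, ← Real.exp_add, Real.exp_lt_exp] at h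
      linarith
    have h2 := hstep k (by omega)
    rw [MSD.meshStep] at h2
    have h3 : 0 < MSD.node T r M (m + 1) - MSD.node T r M k := sub_pos.2 (hnode hk)
    have h4 : MSD.node T r M (m + 1) - MSD.node T r M k ≤ κ⁻¹ := by
      rw [← one_div, le_div_iff₀ hκ]
      linarith
    have h5 : κ ^ α ≤ (MSD.node T r M (m + 1) - MSD.node T r M k) ^ (-α) := by
      have := Real.rpow_le_rpow_of_nonpos h3 h4 (show -α ≤ 0 by linarith)
      rwa [Real.inv_rpow hκ.le, Real.rpow_neg hκ.le, inv_inv] at this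
    have h6 : κ ^ α / Real.Gamma (1 - α) ≤ l1Coeff α T r M (m + 1) k :=
      (div_le_div_of_nonneg_right h5 hΓ.le).trans
        (kernel_div_Gamma_le_l1Coeff hα0 hα1 hT hr hM (by omega))
    have h7 : max (B (k + 1)) θ - max (B k) θ ≤ B (k + 1) - B k := by
      rw [max_eq_left h.le]
      linarith [le_max_left (B k) θ]
    have h8 : 0 ≤ κ ^ α / Real.Gamma (1 - α) := by positivity
    exact mul_le_mul h7 h6 h8 (sub_nonneg.2 hinc)

/-- Stability of the scheme on fine meshes: a right-hand side of size `t_m^(-α)` produces a bounded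
solution. -/
theorem exists_l1_stability (hα0 : 0 < α) (hα1 : α < 1) (hT : 0 < T) (hr : 1 ≤ r) (lam : ℝ) :
    ∃ (S : ℝ) (M₀ : ℕ), 0 ≤ S ∧ ∀ M : ℕ, 1 ≤ M → M₀ ≤ M → ∀ (e : ℕ → ℝ) (D : ℝ), e 0 = 0 → 0 ≤ D →
      (∀ m, m < M → |MSD.l1Deriv α T r M e (m + 1) + lam * e (m + 1)|
        ≤ D * MSD.node T r M (m + 1) ^ (-α)) → ∀ m ≤ M, |e m| ≤ S * D := by
  have hΓ := Real.Gamma_pos_of_pos (show 0 < 1 - α by linarith)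
  have hq : 0 < 1 - Real.exp (-(1 / 2)) := by
    have : Real.exp (-(1 / 2)) < 1 := Real.exp_lt_one_iff.2 (by norm_num)
    linarith
  have hq1 : 1 - Real.exp (-(1 / 2)) ≤ 1 := by linarith [Real.exp_pos (-(1 / 2))]
  -- `κ` is chosen so that half of the L1 derivative of the barrier absorbs `|lam|` times the
  -- barrier, which leaves the other half for the term `t_m^(-α)`.
  set X := 2 * (|lam| + 1) * Real.Gamma (1 - α) / (1 - Real.exp (-(1 / 2))) with hX
  have hX0 : 0 < X := by positivity
  set κ := X ^ (1 / α) with hκdef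
  have hκ : 0 < κ := by positivity
  have hκα : κ ^ α = X := by
    rw [hκdef, ← Real.rpow_mul hX0.le, one_div_mul_cancel hα0.ne', Real.rpow_one]
  have hκα' : κ ^ α / Real.Gamma (1 - α) * (1 - Real.exp (-(1 / 2))) = 2 * (|lam| + 1) := by
    rw [hκα, hX]
    field_simp
  obtain ⟨M₀, hM₀⟩ := exists_nat_ge (2 * κ * (r * T))
  refine ⟨2 * Real.Gamma (1 - α) * Real.exp (κ * T), M₀, by positivity,
    fun M hM hMM e D he0 hD he m hm => ?_⟩
  have hMpos : (0 : ℝ) < M := by positivity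
  have hstep : ∀ k, k < M → κ * MSD.meshStep T r M k ≤ 1 / 2 := fun k hk => by
    have h1 := meshStep_le hT hr hM hk
    have h2 : (M₀ : ℝ) ≤ M := by exact_mod_cast hMM
    have h3 : κ * (r * T / M) ≤ 1 / 2 := by
      rw [← mul_div_assoc, div_le_iff₀ hMpos]
      linarith
    exact (mul_le_mul_of_nonneg_left h1 hκ.le).trans h3
  have hdiag : ∀ m, m < M → 0 < l1Coeff α T r M (m + 1) m + lam := fun m hm => by
    have h1 := kernel_div_Gamma_le_l1Coeff (r := r) hα0 hα1 hT hr hM (le_refl (m + 1))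
    rw [← MSD.meshStep] at h1
    have hs := meshStep_pos hT hr hM m
    have h2 : MSD.meshStep T r M m ≤ κ⁻¹ := by
      rw [← one_div, le_div_iff₀ hκ]
      linarith [hstep m hm]
    have h3 : κ ^ α ≤ MSD.meshStep T r M m ^ (-α) := by
      have := Real.rpow_le_rpow_of_nonpos hs h2 (show -α ≤ 0 by linarith)
      rwa [Real.inv_rpow hκ.le, Real.rpow_neg hκ.le, inv_inv] at this
    have h4 : κ ^ α / Real.Gamma (1 - α) ≤ MSD.meshStep T r M m ^ (-α) / Real.Gamma (1 - α) :=
      div_le_div_of_nonneg_right h3 hΓ.le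
    have h5 : 0 ≤ κ ^ α / Real.Gamma (1 - α) := by positivity
    have h6 : 2 * (|lam| + 1) ≤ κ ^ α / Real.Gamma (1 - α) := by
      rw [← hκα']
      exact mul_le_of_le_one_right h5 hq1
    linarith [neg_abs_le lam, abs_nonneg lam]
  set E := 2 * Real.Gamma (1 - α) * D with hE
  have hE0 : 0 ≤ E := by positivity
  have key := abs_le_of_abs_l1Deriv_add_le (e := e) (B := fun k => E * barrier κ T r M k)
    hα0 hα1 hT hr hM hdiag (by simp [he0, barrier]) (fun k hk => ?_) m hm
  · refine key.trans ?_
    have hb : barrier κ T r M m ≤ Real.exp (κ * T) := by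
      rw [barrier]
      split_ifs
      · positivity
      · have := node_le hT hr hM hm
        gcongr
    calc _ = E * barrier κ T r M m := by ring
      _ ≤ E * Real.exp (κ * T) := mul_le_mul_of_nonneg_left hb hE0
      _ = _ := by rw [hE]; ring
  · refine (he k hk).trans ?_
    have h1 := kernel_le_l1Deriv_barrier (r := r) hκ hα0 hα1 hT hr hM k
    have h2 := mul_barrier_le_l1Deriv_barrier hκ hα0 hα1 hT hr hM hstep hk
    rw [← mul_assoc, hκα'] at h2
    have hb : 0 ≤ barrier κ T r M (k + 1) := by rw [barrier]; split_ifs <;> positivity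
    have h3 : -|lam| * barrier κ T r M (k + 1) ≤ lam * barrier κ T r M (k + 1) :=
      mul_le_mul_of_nonneg_right (neg_abs_le lam) hb
    have h4 : MSD.node T r M (k + 1) ^ (-α) / (2 * Real.Gamma (1 - α))
        ≤ MSD.l1Deriv α T r M (barrier κ T r M) (k + 1) + lam * barrier κ T r M (k + 1) := by
      have : MSD.node T r M (k + 1) ^ (-α) / (2 * Real.Gamma (1 - α))
        = (MSD.node T r M (k + 1) ^ (-α) / Real.Gamma (1 - α)) / 2 := by field_simp
      rw [this]
      linarith
    rw [l1Deriv_const_mul]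
    calc D * MSD.node T r M (k + 1) ^ (-α)
        = E * (MSD.node T r M (k + 1) ^ (-α) / (2 * Real.Gamma (1 - α))) := by
          rw [hE]; field_simp
      _ ≤ E * _ := mul_le_mul_of_nonneg_left h4 hE0
      _ = _ := by ring

theorem MSD.IsL1Solution.unique (hα1 : α < 1) (hT : 0 < T) (hr : 1 ≤ r) (hM : 1 ≤ M) {n : ℕ}
    {f : ℝ → ℝ} (hnd : MSD.IsNondegenerate α T lam r M) {V W : ℕ → ℝ}
    (hV : MSD.IsL1Solution α T lam r n M f V) (hW : MSD.IsL1Solution α T lam r n M f W) :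
    ∀ m ≤ M, V m = W m := by
  intro m
  induction m using Nat.strong_induction_on with
  | _ m ih =>
    intro hm
    rcases m with _ | m
    · rw [hV.init, hW.init]
    have e := (hV.eqn (m + 1) (by omega) hm).trans (hW.eqn (m + 1) (by omega) hm).symm
    have hsum : ∑ k ∈ Finset.range m, (V (k + 1) - V k) * l1Coeff α T r M (m + 1) k
        = ∑ k ∈ Finset.range m, (W (k + 1) - W k) * l1Coeff α T r M (m + 1) k := by
      refine Finset.sum_congr rfl fun k hk => ?_
      rw [Finset.mem_range] at hk
      rw [ih k (by omega) (by omega), ih (k + 1) (by omega) (by omega)]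
    rw [l1Deriv_eq_sum, l1Deriv_eq_sum, Finset.sum_range_succ, Finset.sum_range_succ, hsum,
      ih m (by omega) (by omega), l1Coeff_diag hα1 hT hr hM] at e
    have h : (MSD.meshStep T r M m ^ (-α) / Real.Gamma (2 - α) + lam) * (V (m + 1) - W (m + 1))
        = 0 := by linarith
    rcases mul_eq_zero.1 h with h | h
    · exact absurd h (hnd m hm)
    · linarith

end Scheme

theorem exists_error_bound_fine_mesh {α T lam r : ℝ} {n : ℕ} {f u : ℝ → ℝ} (hα0 : 0 < α)
    (hα1 : α < 1) (hT : 0 < T) (hr : 1 ≤ r) (hf : PowerRegular T 0 f)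
    (hu : MSD.IsRelaxationSolution α T lam f u) :
    ∃ (Q : ℝ) (M₀ : ℕ), 0 ≤ Q ∧ ∀ M : ℕ, 1 ≤ M → M₀ ≤ M → ∀ V : ℕ → ℝ,
      MSD.IsL1Solution α T lam r n M f V → ∀ m ≤ M,
        |u (MSD.node T r M m) - MSD.recover α T lam r n M f V m|
          ≤ Q * MSD.meshParam T r M ^ min (2 - α) (r * (n + 1) * α) := by
  have hr0 : 0 < r := by linarith
  -- Lowering the exponent to `μ / r`, where `μ` is the claimed order, enforces `r γ ≤ 2 - α`.
  set γ := min ((2 - α) / r) ((n + 1) * α) with hγ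
  have hγ0 : 0 < γ := lt_min (div_pos (by linarith) hr0) (by positivity)
  have hrγ : r * γ = min (2 - α) (r * (n + 1) * α) := by
    rw [hγ, mul_min_of_nonneg _ _ hr0.le, mul_div_cancel₀ _ hr0.ne', mul_assoc]
  have hrγ' : r * γ ≤ 2 - α := hrγ.trans_le (min_le_left _ _)
  set v := remainder α lam n f u with hvdef
  have hv : PowerRegular T γ v :=
    (remainder_powerRegular hα0 hα1 hT hf hu).of_le (min_le_right _ _)
  have hv0 : v 0 = 0 := remainder_at_zero hu
  have hvc := hv.continuousOn_Icc hγ0 hv0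
  obtain ⟨v', v'', hd, hd', _, b1, b2⟩ := hv.derivs
  have hv' : PowerBounded T (γ - 1) v' :=
    ⟨fun t ht => (hd' t ht).continuousAt.continuousWithinAt, b1⟩
  have heq : EqOn (MSD.fracIntegral (1 - α) v')
      (fun s => MSD.iterOp α lam n f s - lam * v s) (Ioc 0 T) :=
    fracIntegral_deriv_of_eq_fracIntegral hα0 hα1 hγ0 hT hvc hv0 hd hv'
      ((hf.iterOp hα0 n).powerBounded.sub ((remainder_powerBounded hα0 hT hf hu).const_mul lam))
      ((hf.iterOp hα0 n).cont.sub (continuousOn_const.mul hv.cont))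
      fun t ht => remainder_eq_fracIntegral hα0 hα1 hT hf hu ht
  obtain ⟨K, hK0, hK⟩ := exists_truncation_error_bound hα0 hα1 hT hr hγ0 hrγ' hvc hv0 hd hd' b1 b2
  obtain ⟨S, M₀, hS0, hS⟩ := exists_l1_stability hα0 hα1 hT hr lam
  refine ⟨S * K, M₀, mul_nonneg hS0 hK0, fun M hM hMM V hV m hm => ?_⟩
  have hτ := meshParam_pos (r := r) hT hM
  have h := hS M hM hMM (fun k => v (MSD.node T r M k) - V k)
    (K * MSD.meshParam T r M ^ (r * γ)) (by simp [node_zero hr, hv0, hV.init]) (by positivity)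
    (fun k hk => ?_) m hm
  · rw [← hrγ, mul_assoc]
    have e : u (MSD.node T r M m) - MSD.recover α T lam r n M f V m
        = v (MSD.node T r M m) - V m := by
      rw [MSD.recover, hvdef, remainder]
      ring
    rw [e]
    exact h
  · have h1 := hK M hM k hk
    have h2 := hV.eqn (k + 1) (by omega) hk
    have h3 := heq ⟨node_pos (r := r) hT hM (Nat.le_add_left 1 k), node_le hT hr hM hk⟩
    rw [l1Deriv_sub, mul_assoc]
    refine le_trans (le_of_eq ?_) h1
    rw [h3, ← abs_neg]
    congr 1
    linarith

/-- On one fixed mesh the bound holds with some constant because the scheme determines `V`. -/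
theorem exists_error_bound_fixed_mesh {α T lam r : ℝ} {n M : ℕ} (f u : ℝ → ℝ)
    (hα1 : α < 1) (hT : 0 < T) (hr : 1 ≤ r) (hM : 1 ≤ M) (p : ℝ)
    (hnd : MSD.IsNondegenerate α T lam r M) :
    ∃ Q : ℝ, 0 ≤ Q ∧ ∀ V : ℕ → ℝ, MSD.IsL1Solution α T lam r n M f V → ∀ m ≤ M,
      |u (MSD.node T r M m) - MSD.recover α T lam r n M f V m| ≤ Q * MSD.meshParam T r M ^ p := by
  by_cases h : ∃ W : ℕ → ℝ, MSD.IsL1Solution α T lam r n M f W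
  · obtain ⟨W, hW⟩ := h
    have hτ : 0 < MSD.meshParam T r M ^ p := Real.rpow_pos_of_pos (meshParam_pos hT hM) _
    refine ⟨(∑ k ∈ Finset.range (M + 1),
      |u (MSD.node T r M k) - MSD.recover α T lam r n M f W k|) / MSD.meshParam T r M ^ p,
      by positivity, fun V hV m hm => ?_⟩
    rw [div_mul_cancel₀ _ hτ.ne', MSD.recover, hV.unique hα1 hT hr hM hnd hW m hm,
      ← MSD.recover]
    exact Finset.single_le_sum
      (f := fun k => |u (MSD.node T r M k) - MSD.recover α T lam r n M f W k|)
      (fun k _ => abs_nonneg _) (Finset.mem_range.2 (by omega))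
  · exact ⟨0, le_rfl, fun V hV => absurd ⟨V, hV⟩ h⟩

theorem mainTheorem2
    (α T lam r : ℝ) (n : ℕ)
    (hα0 : 0 < α) (hα1 : α < 1) (hT : 0 < T) (hr : 1 ≤ r)
    (f f' f'' : ℝ → ℝ) (σ σ' C : ℝ) (hσ : σ < 1) (hσ' : σ' < 1)
    (hf' : ∀ t ∈ Set.Icc 0 T, HasDerivWithinAt f (f' t) (Set.Icc 0 T) t)
    (hf'' : ∀ t ∈ Set.Ioc 0 T, HasDerivWithinAt f' (f'' t) (Set.Icc 0 T) t)
    (hbound' : ∀ t ∈ Set.Ioc 0 T, |f' t| ≤ C * t ^ (-σ))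
    (hbound'' : ∀ t ∈ Set.Ioc 0 T, |f'' t| ≤ C * t ^ (-σ'))
    (u : ℝ → ℝ) (hu : MSD.IsRelaxationSolution α T lam f u) :
    ∃ Q : ℝ, 0 < Q ∧ ∀ M : ℕ, 1 ≤ M → MSD.IsNondegenerate α T lam r M →
      ∀ V : ℕ → ℝ, MSD.IsL1Solution α T lam r n M f V →
        ∀ m : ℕ, 1 ≤ m → m ≤ M →
          |u (MSD.node T r M m) - MSD.recover α T lam r n M f V m|
            ≤ Q * MSD.meshParam T r M ^ min (2 - α) (r * (n + 1) * α) := by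
  have hf := powerRegular_of_hasDerivWithinAt hσ hσ' hf' hf'' hbound' hbound''
  obtain ⟨Q₀, M₀, hQ₀, hfine⟩ := exists_error_bound_fine_mesh (n := n) hα0 hα1 hT hr hf hu
  set p := min (2 - α) (r * (n + 1) * α) with hp
  have hcoarse : ∀ M : ℕ, ∃ Q : ℝ, 0 ≤ Q ∧ (1 ≤ M → MSD.IsNondegenerate α T lam r M →
      ∀ V : ℕ → ℝ, MSD.IsL1Solution α T lam r n M f V → ∀ m ≤ M,
        |u (MSD.node T r M m) - MSD.recover α T lam r n M f V m|
          ≤ Q * MSD.meshParam T r M ^ p) := fun M => by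
    by_cases h : 1 ≤ M ∧ MSD.IsNondegenerate α T lam r M
    · obtain ⟨Q, hQ, hb⟩ := exists_error_bound_fixed_mesh (n := n) f u hα1 hT hr h.1 p h.2
      exact ⟨Q, hQ, fun _ _ => hb⟩
    · exact ⟨0, le_rfl, fun h1 h2 => absurd ⟨h1, h2⟩ h⟩
  choose Q hQ hb using hcoarse
  have hsum : 0 ≤ ∑ M ∈ Finset.range M₀, Q M := Finset.sum_nonneg fun M _ => hQ M
  refine ⟨Q₀ + ∑ M ∈ Finset.range M₀, Q M + 1, by linarith, fun M hM hnd V hV m _ hm => ?_⟩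
  have hτ : 0 ≤ MSD.meshParam T r M ^ p := Real.rpow_nonneg (meshParam_pos hT hM).le _
  rcases le_or_gt M₀ M with h | h
  · refine (hfine M hM h V hV m hm).trans (mul_le_mul_of_nonneg_right ?_ hτ)
    linarith
  · refine (hb M hM hnd V hV m hm).trans (mul_le_mul_of_nonneg_right ?_ hτ)
    have := Finset.single_le_sum (fun k _ => hQ k) (Finset.mem_range.2 h)
    linarith
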